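/- \textbf{Definitions.} A (real-time) \emph{deterministic visibly push-down automaton} (DVPDA) $M=(Q,\Sigma,\Gamma,\delta,\bot)$ has a finite non-empty state set $Q$, a finite input alphabet that is a disjoint union $\Sigma=\Sigma_{\mathrm{call}}\cup\Sigma_{\mathrm{int}}\cup\Sigma_{\mathrm{ret}}$, a finite stack alphabet $\Gamma\ni\bot$, and total transition functions $\delta_c:Q\times\Sigma_{\mathrm{call}}\to Q\times(\Gamma\setminus\{\bot\})$ (push a symbol), $\delta_i:Q\times\Sigma_{\mathrm{int}}\to Q$ (stack unchanged) and $\delta_r:Q\times\Sigma_{\mathrm{ret}}\times\Gamma\to Q$ (read and pop the top symbol, except that the bottom symbol $\bot$ is only read and never popped). It is \emph{very visibly} (DVVPDA) if the symbol pushed by $\delta_c(q,\sigma)$ depends only on $\sigma$, and a \emph{visibly counter automaton} (DVCA) if $|\Gamma\setminus\{\bot\}|=1$. A word $w\in\Sigma^*$ \emph{synchronizes} $M$ if there is a state $\overline q$ such that for every $q\in Q$ the run on $w$ from the configuration $(q,\bot)$ ends in a configuration $(\overline q,\upsilon_q)$, where in the \emph{empty} stack model $\upsilon_q=\bot$ for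 all $q$, in the \emph{same} stack model $\upsilon_q=\upsilon_{q'}$ for all $q,q'$, and in the \emph{arbitrary} stack model nothing is required of the $\upsilon_q$. A \emph{stroke} is a sequence of consecutive configurations of a run in which either no transition decreases the stack height or no transition increases it. For $n\in\mathbb N$, $w$ is an \emph{$n$-turn synchronizing word} if it synchronizes $M$ (in the given stack model) and, for every $q\in Q$, the run on $w$ from $(q,\bot)$ can be split into at most $n+1$ strokes. \textbf{Theorem.} For each of the three stack models (empty, same, arbitrary), each of the following decision problems is in $\mathrm{EXP}$, that is, decided by a deterministic Turing machine in time $2^{p(N)}$ for some polynomial $p$, where $N$ is the length of the explicit description of the input automaton by its sizes and transition tables: \begin{enumerate} \item for each of the classes DVPDA, DVVPDA and DVCA: given an automaton $M$ of the class, does $M$ have a synchronizing word? \item for each of the classes DVPDA, DVVPDA and DVCA and each fixed $n\in\mathbb N$ (including $n=0$): given an automaton $M$ of the class, does $M$ have an $n$-turn synchronizing word? \item given a DVPDA $M$ with $\Sigma_{\mathrm{ret}}=\emptyset$, does $M$ have a synchronizing word? \item given a DVPDA $M$ with $\Sigma_{\mathrm{ret}}\neq\emptyset$, does $M$ have a synchronizing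 word? \end{enumerate} -/

import Mathlib

/-! ## Exponential time

Turing machines are Mathlib's multi-stack machines `Turing.FinTM2`: finitely many stacks, labels and
internal states. -/

open Classical in
/-- The complexity class EXP: the languages over `{0,1}` decided by a deterministic Turing machine
within `2 ^ p(n)` steps on all inputs of length `n`, for some polynomial `p`. The machine starts
with the input word on its input stack and halts with the answer bit on its output stack. -/
def InEXP (L : Language Bool) : Prop :=
  ∃ T : Turing.TM2ComputableInTime (id : List Bool → List Bool) Computability.encodeBool
      (fun w => decide (w ∈ L)),
    ∃ p : Polynomial ℕ, ∀ n, T.time n ≤ 2 ^ p.eval n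

/-! ## Deterministic visibly push-down automata -/

/-- Input letters of a visibly push-down automaton: the disjoint union of the alphabet `C` of call
letters, the alphabet `I` of internal letters and the alphabet `R` of return letters. -/
inductive Letter (C I R : Type) : Type
  | call (a : C)
  | int (a : I)
  | ret (a : R)

/-- A real-time deterministic visibly push-down automaton (without initial and final states) with
states `Q`, call letters `C`, internal letters `I`, return letters `R`. Here `G` is the set of stack
symbols other than the bottom symbol `⊥`, so the stack alphabet is `Option G` with `none` for `⊥`.
A call letter pushes a symbol of `G`; an internal letter leaves the stack unchanged; a return
letter reads the top symbol and pops it, except that `⊥` is only read. -/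
structure DVPDA (Q C I R G : Type) where
  /-- transitions on call letters -/
  callTrans : Q → C → Q × G
  /-- transitions on internal letters -/
  intTrans : Q → I → Q
  /-- transitions on return letters, depending on the symbol on top of the stack -/
  retTrans : Q → R → Option G → Q

namespace DVPDA

variable {Q C I R G : Type}

/-- One step on a configuration `(q, v)`. The list `v` holds the stack content above the bottom
symbol, with the top of the stack as its head. -/
def step (M : DVPDA Q C I R G) : Q × List G → Letter C I R → Q × List G
  | (q, v), .call a => ((M.callTrans q a).1, (M.callTrans q a).2 :: v)
  | (q, v), .int a => (M.intTrans q a, v)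
  | (q, []), .ret a => (M.retTrans q a none, [])
  | (q, g :: v), .ret a => (M.retTrans q a (some g), v)

/-- The configuration reached from `c` by reading a word. -/
def run (M : DVPDA Q C I R G) (c : Q × List G) (w : List (Letter C I R)) : Q × List G :=
  w.foldl M.step c

/-- The stack height after reading `w` from the configuration `c` (not counting `⊥`). -/
def height (M : DVPDA Q C I R G) (c : Q × List G) (w : List (Letter C I R)) : ℕ :=
  (M.run c w).2.length

/-- Very visibly: the pushed symbol depends on the call letter only. -/
def VeryVisibly (M : DVPDA Q C I R G) : Prop :=
  ∀ (a : C) (p q : Q), (M.callTrans p a).2 = (M.callTrans q a).2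

end DVPDA

/-- The three requirements on the stack contents after reading a synchronizing word. -/
inductive StackModel : Type
  | empty
  | same
  | arb

namespace DVPDA

variable {Q C I R G : Type}

/-- The word `w` synchronizes `M` in the given stack model: all runs that start with an empty stack
end in one common state, and the final stacks are all empty, are all equal, or are arbitrary. -/
def Synchronizes (M : DVPDA Q C I R G) (S : StackModel) (w : List (Letter C I R)) : Prop :=
  (∃ s : Q, ∀ q : Q, (M.run (q, []) w).1 = s) ∧
    match S with
    | .empty => ∀ q : Q, (M.run (q, []) w).2 = []
    | .same => ∀ q q' : Q, (M.run (q, []) w).2 = (M.run (q', []) w).2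
    | .arb => True

/-- No transition of the run from `c` on `w` decreases the stack height. -/
def IsUpstroke (M : DVPDA Q C I R G) (c : Q × List G) (w : List (Letter C I R)) : Prop :=
  ∀ u a, u ++ [a] <+: w → M.height c u ≤ M.height c (u ++ [a])

/-- No transition of the run from `c` on `w` increases the stack height. -/
def IsDownstroke (M : DVPDA Q C I R G) (c : Q × List G) (w : List (Letter C I R)) : Prop :=
  ∀ u a, u ++ [a] <+: w → M.height c (u ++ [a]) ≤ M.height c u

/-- The run from `c` on `w` can be split into at most `m` strokes (pieces may be empty). -/
def AtMostStrokes (M : DVPDA Q C I R G) : ℕ → Q × List G → List (Letter C I R) → Prop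
  | 0, _, w => w = []
  | m + 1, c, w => ∃ u v, w = u ++ v ∧ (M.IsUpstroke c u ∨ M.IsDownstroke c u) ∧
      M.AtMostStrokes m (M.run c u) v

/-- `w` is an `n`-turn synchronizing word for `M` in the given stack model: it synchronizes, and
for every state `q` the run from `q` with empty stack consists of at most `n + 1` strokes. -/
def TurnSynchronizes (M : DVPDA Q C I R G) (n : ℕ) (S : StackModel) (w : List (Letter C I R)) :
    Prop :=
  M.Synchronizes S w ∧ ∀ q : Q, M.AtMostStrokes (n + 1) (q, []) w

end DVPDA

/-! ## Automata as inputs of decision problems -/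

/-- A finite DVPDA given explicitly: its state set (non-empty) and its alphabets are initial
segments of `ℕ`. -/
structure DVPDAInput where
  /-- number of states -/
  numStates : ℕ
  /-- number of call letters -/
  numCalls : ℕ
  /-- number of internal letters -/
  numInts : ℕ
  /-- number of return letters -/
  numRets : ℕ
  /-- number of stack symbols other than `⊥` -/
  numSymbols : ℕ
  states_pos : 0 < numStates
  /-- the automaton itself -/
  aut : DVPDA (Fin numStates) (Fin numCalls) (Fin numInts) (Fin numRets) (Fin numSymbols)

namespace DVPDAInput

/-- The table of transitions on call letters: state after state and, for each state, letter after
letter, the target state and the pushed symbol. -/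
def callTable (A : DVPDAInput) : List ℕ :=
  (List.finRange A.numStates).flatMap fun q => (List.finRange A.numCalls).flatMap fun a =>
    [((A.aut.callTrans q a).1 : ℕ), ((A.aut.callTrans q a).2 : ℕ)]

/-- The table of transitions on internal letters. -/
def intTable (A : DVPDAInput) : List ℕ :=
  (List.finRange A.numStates).flatMap fun q => (List.finRange A.numInts).flatMap fun a =>
    [(A.aut.intTrans q a : ℕ)]

/-- The table of transitions on return letters: for each state and letter, the target state for the
top symbol `⊥`, followed by those for the other stack symbols. -/
def retTable (A : DVPDAInput) : List ℕ :=
  (List.finRange A.numStates).flatMap fun q => (List.finRange A.numRets).flatMap fun a =>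
    (A.aut.retTrans q a none : ℕ) ::
      (List.finRange A.numSymbols).flatMap fun g => [(A.aut.retTrans q a (some g) : ℕ)]

/-- The description of an automaton as a list of numbers: the five sizes, then the tables. -/
def toNats (A : DVPDAInput) : List ℕ :=
  [A.numStates, A.numCalls, A.numInts, A.numRets, A.numSymbols] ++
    (A.callTable ++ (A.intTable ++ A.retTable))

/-- The description of an automaton as a binary word. The number `n` is written `1ⁿ0`; since the
tables list the elements of all sets involved, the length of the word is polynomially related to
that of any other explicit description. -/
def encode (A : DVPDAInput) : List Bool :=
  A.toNats.flatMap fun n => List.replicate n true ++ [false]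

end DVPDAInput

theorem unary_flatMap_injective :
    Function.Injective fun l : List ℕ => l.flatMap fun n => List.replicate n true ++ [false] := by
  intro l
  induction l with
  | nil =>
    intro l' h
    cases l' with
    | nil => rfl
    | cons b l' => simp at h
  | cons a l ih =>
    intro l' h
    cases l' with
    | nil => simp at h
    | cons b l' =>
      simp only [List.flatMap_cons, List.append_assoc, List.singleton_append] at h
      have key : ∀ (a b : ℕ) (s t : List Bool),
          List.replicate a true ++ false :: s = List.replicate b true ++ false :: t →
            a = b ∧ s = t := by
        intro a
        induction a with
        | zero => intro b s t h; cases b <;> simp_all [List.replicate_succ]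
        | succ a iha =>
          intro b s t h
          cases b with
          | zero => simp [List.replicate_succ] at h
          | succ b =>
            simp only [List.replicate_succ, List.cons_append, List.cons.injEq, true_and] at h
            obtain ⟨h1, h2⟩ := iha b s t h
            exact ⟨by rw [h1], h2⟩
      obtain ⟨h1, h2⟩ := key _ _ _ _ h
      rw [h1, ih h2]

theorem flatMap_eq_of_length {α β : Type} (f g : α → List β)
    (hlen : ∀ x, (f x).length = (g x).length) (l : List α) (h : l.flatMap f = l.flatMap g) :
    ∀ x ∈ l, f x = g x := by
  induction l with
  | nil => simp
  | cons a l ih =>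
    simp only [List.flatMap_cons] at h
    obtain ⟨h1, h2⟩ := List.append_inj h (hlen a)
    intro x hx
    rcases List.mem_cons.1 hx with rfl | hx
    · exact h1
    · exact ih h2 x hx

/-- Distinct automata have distinct descriptions. -/
theorem DVPDAInput.encode_injective : Function.Injective DVPDAInput.encode := by
  rintro ⟨nq, nc, ni, nr, ng, hq, ⟨c, i, r⟩⟩ ⟨nq', nc', ni', nr', ng', hq', ⟨c', i', r'⟩⟩ h
  have h' := unary_flatMap_injective h
  simp only [toNats, List.cons_append, List.nil_append, List.cons.injEq] at h'
  obtain ⟨rfl, rfl, rfl, rfl, rfl, h'⟩ := h'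
  obtain ⟨hc, h'⟩ := List.append_inj h' (by simp [callTable])
  obtain ⟨hi, hr⟩ := List.append_inj h' (by simp [intTable])
  have ec : c = c' := by
    funext q a
    have h1 := flatMap_eq_of_length _ _ (by simp) _ hc q (List.mem_finRange q)
    have h2 := flatMap_eq_of_length _ _ (by simp) _ h1 a (List.mem_finRange a)
    simp only [List.cons.injEq, and_true] at h2
    exact Prod.ext (Fin.ext h2.1) (Fin.ext h2.2)
  have ei : i = i' := by
    funext q a
    have h1 := flatMap_eq_of_length _ _ (by simp) _ hi q (List.mem_finRange q)
    have h2 := flatMap_eq_of_length _ _ (by simp) _ h1 a (List.mem_finRange a)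
    simp only [List.cons.injEq, and_true] at h2
    exact Fin.ext h2
  have er : r = r' := by
    funext q a g
    have h1 := flatMap_eq_of_length _ _ (by simp) _ hr q (List.mem_finRange q)
    have h2 := flatMap_eq_of_length _ _ (by simp) _ h1 a (List.mem_finRange a)
    simp only [List.cons.injEq] at h2
    cases g with
    | none => exact Fin.ext h2.1
    | some g =>
      have h3 := flatMap_eq_of_length _ _ (by simp) _ h2.2 g (List.mem_finRange g)
      simp only [List.cons.injEq, and_true] at h3
      exact Fin.ext h3
  subst ec ei er
  rfl

/-! ## The synchronization problems -/

/-- The classes of automata: deterministic visibly push-down automata, deterministic very visibly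
push-down automata, and deterministic visibly (one) counter automata. -/
inductive AutomatonClass : Type
  | dvpda
  | dvvpda
  | dvca

/-- Membership of an automaton in a class; a DVCA has exactly one stack symbol other than `⊥`. -/
def AutomatonClass.Contains : AutomatonClass → DVPDAInput → Prop
  | .dvpda, _ => True
  | .dvvpda, A => A.aut.VeryVisibly
  | .dvca, A => A.numSymbols = 1

/-- `Sync-𝒞-S`: the descriptions of the automata of the class that have a synchronizing word in the
stack model `S`. -/
def SyncProblem (𝒞 : AutomatonClass) (S : StackModel) : Language Bool :=
  {x | ∃ A : DVPDAInput, A.encode = x ∧ 𝒞.Contains A ∧ ∃ w, A.aut.Synchronizes S w}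

/-- `n-Turn-Sync-𝒞-S`: the descriptions of the automata of the class that have an `n`-turn
synchronizing word in the stack model `S`. -/
def TurnSyncProblem (n : ℕ) (𝒞 : AutomatonClass) (S : StackModel) : Language Bool :=
  {x | ∃ A : DVPDAInput, A.encode = x ∧ 𝒞.Contains A ∧ ∃ w, A.aut.TurnSynchronizes n S w}

/-- `Sync-DVPDA-S-NoReturn`: the inputs are the DVPDAs without return letters. -/
def SyncNoReturnProblem (S : StackModel) : Language Bool :=
  {x | ∃ A : DVPDAInput, A.encode = x ∧ A.numRets = 0 ∧ ∃ w, A.aut.Synchronizes S w}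

/-- `Sync-DVPDA-S-Return`: the inputs are the DVPDAs with at least one return letter. -/
def SyncReturnProblem (S : StackModel) : Language Bool :=
  {x | ∃ A : DVPDAInput, A.encode = x ∧ A.numRets ≠ 0 ∧ ∃ w, A.aut.Synchronizes S w}

/-!
All runs of a visibly push-down automaton on one word have the same stack height at all times, so
that a word acts on the runs from all states at once. A well-nested word can be read on any stack
without touching it and induces a transformation of the state set; hence there are at most `q ^ q`
different effects of such words, where `q` is the number of states. A word read from the empty stack
splits into a part that leads back to the empty stack, followed by pending calls with well-nested
words between them. Its effect on the states is therefore derived by a few closure rules from the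
effects of shorter words (`DVPDA.Der`): append an internal letter, enclose a well-nested word by a
call and a return, append a return letter at the empty stack, append a pending call. The three stack
models differ only in the last rule, which is void for the empty model and requires equal pushed
symbols for the same model. For `n`-turn words the transformations carry a turn counter, whose
parity tells the direction of the current stroke. A synchronizing word exists if and only if a
constant transformation can be derived (`DVPDA.exists_synchronizes_iff'` and
`DVPDA.exists_turnSynchronizes_iff`).

The derivable transformations form the least fixed point of a monotone operator on a set with
`X = 3 (n + 1) ^ 2 P` elements, where `P = N ^ N` and `N` is the length of the input: three kinds of
words, two values of the counter, and a transformation coded by its digits in base `q`. The fixed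
point is reached after `X` rounds (`level_stationary`), so it can be read off from a table of
`X ^ 2` bits, each of which depends on the preceding ones through bounded quantifiers and arithmetic
(`tableRule`).

The time bound for the Turing machine comes in three layers. Structured programs on stacks of bits
are translated to the code of a `Turing.FinTM2`, step by step (`Prog.inEXP_of_runs`). Terms of a
small language, with variables in unary, bounded iteration and look-up in the input and the table,
are compiled to such programs with an explicit bound for the running time (`Tm.comp_runsIn`).
Functions given by terms with polynomially bounded value and cost (`Cmp`, `CmpP`) are closed under
arithmetic, bounded sums and bounded quantifiers. Filling a table bit by bit, in time polynomial in
`P` and the length of the table, then takes exponential time (`inEXP_of_table`).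
-/


/-! ### Structured stack programs -/

/-- Structured programs over stacks of bits, which are indexed by `ℕ`. The program `cases k p q r`
continues with `p`, `q` or `r` when stack `k` is empty, has top `false` or has top `true`; the
program `loop k p` repeats `p` as long as stack `k` is not empty. -/
inductive Prog : Type
  | skip
  | push (k : ℕ) (b : Bool)
  | pop (k : ℕ)
  | seq (p q : Prog)
  | cases (k : ℕ) (p q r : Prog)
  | loop (k : ℕ) (p : Prog)

namespace Prog

open Function

/-- `p.Runs s s' t`: started with stack contents `s`, the program `p` ends with stack contents `s'`
after `t` elementary steps. -/
inductive Runs : Prog → (ℕ → List Bool) → (ℕ → List Bool) → ℕ → Prop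
  | skip (s) : Runs skip s s 1
  | push (k b s) : Runs (push k b) s (update s k (b :: s k)) 1
  | pop (k s) : Runs (pop k) s (update s k (s k).tail) 1
  | seq {p q s₁ s₂ s₃ t₁ t₂} (h₁ : Runs p s₁ s₂ t₁) (h₂ : Runs q s₂ s₃ t₂) :
      Runs (seq p q) s₁ s₃ (t₁ + t₂)
  | cases_nil {k p q r s s' t} (h : s k = []) (h' : Runs p s s' t) :
      Runs (cases k p q r) s s' (t + 1)
  | cases_false {k p q r s s' t l} (h : s k = false :: l) (h' : Runs q s s' t) :
      Runs (cases k p q r) s s' (t + 1)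
  | cases_true {k p q r s s' t l} (h : s k = true :: l) (h' : Runs r s s' t) :
      Runs (cases k p q r) s s' (t + 1)
  | loop_nil {k p s} (h : s k = []) : Runs (loop k p) s s 1
  | loop_cons {k p s₁ s₂ s₃ t₁ t₂} (h : s₁ k ≠ []) (h₁ : Runs p s₁ s₂ t₁)
      (h₂ : Runs (loop k p) s₂ s₃ t₂) : Runs (loop k p) s₁ s₃ (t₁ + t₂ + 1)

/-- Upper bound for the stack indices of a program. -/
def maxStack : Prog → ℕ
  | skip => 0
  | push k _ => k
  | pop k => k
  | seq p q => max p.maxStack q.maxStack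
  | cases k p q r => max k (max p.maxStack (max q.maxStack r.maxStack))
  | loop k p => max k p.maxStack

/-- The labels of the machine code of a program. -/
def Label : Prog → Type
  | skip => Unit
  | push _ _ => Unit
  | pop _ => Unit
  | seq p q => p.Label ⊕ q.Label
  | cases _ p q r => Option (p.Label ⊕ (q.Label ⊕ r.Label))
  | loop _ p => Option p.Label

theorem finite_label : ∀ p : Prog, Finite p.Label
  | skip => inferInstanceAs (Finite Unit)
  | push _ _ => inferInstanceAs (Finite Unit)
  | pop _ => inferInstanceAs (Finite Unit)
  | seq p q =>
    have := p.finite_label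
    have := q.finite_label
    inferInstanceAs (Finite (p.Label ⊕ q.Label))
  | cases _ p q r =>
    have := p.finite_label
    have := q.finite_label
    have := r.finite_label
    inferInstanceAs (Finite (Option (p.Label ⊕ (q.Label ⊕ r.Label))))
  | loop _ p =>
    have := p.finite_label
    inferInstanceAs (Finite (Option p.Label))

/-- The label at which the code of a program is entered. -/
def start : ∀ p : Prog, p.Label
  | skip => ()
  | push _ _ => ()
  | pop _ => ()
  | seq p _ => Sum.inl p.start
  | cases _ _ _ _ => none
  | loop _ _ => none

section Code

open Turing.TM2.Stmt

variable {L : Type} (N : ℕ)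

/-- The machine code of a program on the stacks `0, …, N`, placed at the labels `emb l` of a machine
and ending with a jump to `exit`. The internal state of the machine holds a symbol only while a
statement is carried out; it is `none` at all jumps. -/
def code : ∀ p : Prog, (p.Label → L) → L → p.Label →
    Turing.TM2.Stmt (fun _ : Fin (N + 1) => Bool) L (Option Bool)
  | skip, _, exit, _ => goto fun _ => exit
  | push k b, _, exit, _ => Turing.TM2.Stmt.push (Fin.ofNat (N + 1) k) (fun _ => b)
    (goto fun _ => exit)
  | pop k, _, exit, _ =>
    Turing.TM2.Stmt.pop (Fin.ofNat (N + 1) k) (fun _ _ => none) (goto fun _ => exit)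
  | seq p q, emb, _, Sum.inl l => p.code (fun l => emb (Sum.inl l)) (emb (Sum.inr q.start)) l
  | seq _ q, emb, exit, Sum.inr l => q.code (fun l => emb (Sum.inr l)) exit l
  | cases k p q r, emb, _, none =>
    peek (Fin.ofNat (N + 1) k) (fun _ o => o) <|
      branch (fun o => o == none)
        (load (fun _ => none) (goto fun _ => emb (some (Sum.inl p.start)))) <|
      branch (fun o => o == some false)
        (load (fun _ => none) (goto fun _ => emb (some (Sum.inr (Sum.inl q.start)))))
        (load (fun _ => none) (goto fun _ => emb (some (Sum.inr (Sum.inr r.start)))))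
  | cases _ p _ _, emb, exit, some (Sum.inl l) =>
    p.code (fun l => emb (some (Sum.inl l))) exit l
  | cases _ _ q _, emb, exit, some (Sum.inr (Sum.inl l)) =>
    q.code (fun l => emb (some (Sum.inr (Sum.inl l)))) exit l
  | cases _ _ _ r, emb, exit, some (Sum.inr (Sum.inr l)) =>
    r.code (fun l => emb (some (Sum.inr (Sum.inr l)))) exit l
  | loop k p, emb, exit, none =>
    peek (Fin.ofNat (N + 1) k) (fun _ o => o) <|
      branch (fun o => o == none) (load (fun _ => none) (goto fun _ => exit))
        (load (fun _ => none) (goto fun _ => emb (some p.start)))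
  | loop _ p, emb, _, some l => p.code (fun l => emb (some l)) (emb none) l

theorem update_restrict {N k : ℕ} (h : k ≤ N) (s : ℕ → List Bool) (x : List Bool) :
    update (fun i : Fin (N + 1) => s i) (Fin.ofNat (N + 1) k) x =
      fun i : Fin (N + 1) => update s k x i := by
  funext i
  have hk : (Fin.ofNat (N + 1) k : ℕ) = k := Nat.mod_eq_of_lt (Nat.lt_succ_of_le h)
  by_cases hi : i = Fin.ofNat (N + 1) k
  · subst hi
    rw [update_self, hk, update_self]
  · rw [update_of_ne hi, update_of_ne]
    intro h'
    exact hi (Fin.ext (h'.trans hk.symm))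

/-- A machine that contains the code of a program carries the program out, step by step. -/
theorem Runs.simulate {p : Prog} {s s' : ℕ → List Bool} {t : ℕ} (hr : p.Runs s s' t)
    (m : L → Turing.TM2.Stmt (fun _ : Fin (N + 1) => Bool) L (Option Bool))
    (emb : p.Label → L) (exit : L) (hm : ∀ l, m (emb l) = p.code N emb exit l)
    (hN : p.maxStack ≤ N) :
    (flip bind (Turing.TM2.step m))^[t] (some ⟨some (emb p.start), none, fun i => s i⟩) =
      some ⟨some exit, none, fun i => s' i⟩ := by
  induction hr generalizing exit with
  | skip s =>
    simp [flip, Turing.TM2.step, hm, code]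
  | push k b s =>
    simp only [maxStack] at hN
    simpa [flip, Turing.TM2.step, hm, code, Nat.mod_eq_of_lt (Nat.lt_succ_of_le hN)] using
      update_restrict hN s (b :: s k)
  | pop k s =>
    simp only [maxStack] at hN
    simpa [flip, Turing.TM2.step, hm, code, Nat.mod_eq_of_lt (Nat.lt_succ_of_le hN)] using
      update_restrict hN s (s k).tail
  | @seq p q s₁ s₂ s₃ t₁ t₂ h₁ h₂ ih₁ ih₂ =>
    simp only [maxStack, max_le_iff] at hN
    rw [Nat.add_comm t₁, Function.iterate_add_apply]
    erw [ih₁ _ _ (fun l => hm (Sum.inl l)) hN.1]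
    exact ih₂ _ _ (fun l => hm (Sum.inr l)) hN.2
  | cases_nil h _ ih =>
    simp only [maxStack, max_le_iff] at hN
    rw [Function.iterate_succ_apply]
    rw [← ih (fun l => emb (some (Sum.inl l))) exit (fun l => hm (some (Sum.inl l))) hN.2.1]
    congr 1
    have := hm none
    simp [flip, Turing.TM2.step, start, this, code, h, Nat.mod_eq_of_lt (Nat.lt_succ_of_le hN.1)]
  | cases_false h _ ih =>
    simp only [maxStack, max_le_iff] at hN
    rw [Function.iterate_succ_apply]
    rw [← ih (fun l => emb (some (Sum.inr (Sum.inl l)))) exit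
      (fun l => hm (some (Sum.inr (Sum.inl l)))) hN.2.2.1]
    congr 1
    have := hm none
    simp [flip, Turing.TM2.step, start, this, code, h, Nat.mod_eq_of_lt (Nat.lt_succ_of_le hN.1)]
  | cases_true h _ ih =>
    simp only [maxStack, max_le_iff] at hN
    rw [Function.iterate_succ_apply]
    rw [← ih (fun l => emb (some (Sum.inr (Sum.inr l)))) exit
      (fun l => hm (some (Sum.inr (Sum.inr l)))) hN.2.2.2]
    congr 1
    have := hm none
    simp [flip, Turing.TM2.step, start, this, code, h, Nat.mod_eq_of_lt (Nat.lt_succ_of_le hN.1)]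
  | loop_nil h =>
    simp only [maxStack, max_le_iff] at hN
    have := hm none
    simp [flip, Turing.TM2.step, start, this, code, h, Nat.mod_eq_of_lt (Nat.lt_succ_of_le hN.1)]
  | @loop_cons k p s₁ s₂ s₃ t₁ t₂ h h₁ h₂ ih₁ ih₂ =>
    have hN' := hN
    simp only [maxStack, max_le_iff] at hN'
    rw [Function.iterate_succ_apply, Nat.add_comm t₁, Function.iterate_add_apply]
    have h1 := ih₁ _ _ (fun l => hm (some l)) hN'.2
    rw [← ih₂ _ _ hm hN]
    congr 1
    refine Eq.trans ?_ h1
    congr 1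
    have := hm none
    obtain ⟨b, l, hb⟩ := List.exists_cons_of_ne_nil h
    simp [flip, Turing.TM2.step, start, this, code, hb,
      Nat.mod_eq_of_lt (Nat.lt_succ_of_le hN'.1)]

end Code

/-- The machine that runs a program with input stack `0` and output stack `1` and then halts. -/
noncomputable def machine (p : Prog) : Turing.FinTM2 :=
  letI := p.finite_label
  letI : Fintype (Option p.Label) := Fintype.ofFinite _
  { K := Fin (p.maxStack + 2)
    k₀ := 0
    k₁ := 1
    Γ := fun _ => Bool
    Λ := Option p.Label
    main := some p.start
    σ := Option Bool
    initialState := none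
    Γk₀Fin := inferInstanceAs (Fintype Bool)
    m := fun l => l.elim Turing.TM2.Stmt.halt (p.code (p.maxStack + 1) some none) }

/-- A program that turns the input on stack `0` into the one-bit answer on stack `1`, all other
stacks being empty at the beginning and at the end, puts a language into EXP. -/
theorem inEXP_of_runs (p : Prog) (L : Language Bool) (P : Polynomial ℕ)
    (h : ∀ x : List Bool, ∃ b : Bool, (b = true ↔ x ∈ L) ∧ ∃ t, t + 1 ≤ 2 ^ P.eval x.length ∧
      p.Runs (update (fun _ => []) 0 x) (update (fun _ => []) 1 [b]) t) : InEXP L := by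
  classical
  refine ⟨⟨⟨p.machine, Equiv.refl _, Equiv.refl _⟩, fun n => 2 ^ P.eval n, fun x => ?_⟩,
    P, fun n => le_rfl⟩
  choose b hb t ht hr using h
  refine ⟨⟨t x + 1, ?_⟩, ht x⟩
  have hs := (hr x).simulate (p.maxStack + 1)
    (fun l => l.elim Turing.TM2.Stmt.halt (p.code (p.maxStack + 1) some none))
    some none (fun l => rfl) (Nat.le_succ _)
  rw [Function.iterate_succ_apply']
  have e1 : (Turing.initList p.machine (List.map (Equiv.refl Bool).invFun (id x))) =
      (⟨some (some p.start), none, fun i => update (fun _ => []) 0 x (i : ℕ)⟩ :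
        Turing.TM2.Cfg (fun _ : Fin (p.maxStack + 2) => Bool) (Option p.Label) (Option Bool)) := by
    unfold Turing.initList
    congr 1
    funext i
    by_cases hi : i = (0 : Fin (p.maxStack + 2))
    · subst hi
      simp [machine]
      rfl
    · have : Fin.val (n := p.maxStack + 2) i ≠ 0 := fun h => hi (Fin.ext h)
      rw [update_of_ne this]
      exact dif_neg hi
  have e2 : (Turing.haltList p.machine
      (List.map (Equiv.refl Bool).invFun (Computability.encodeBool (decide (x ∈ L))))) =
      (⟨none, none, fun i => update (fun _ => []) 1 [b x] (i : ℕ)⟩ :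
        Turing.TM2.Cfg (fun _ : Fin (p.maxStack + 2) => Bool) (Option p.Label) (Option Bool)) := by
    have hbx : decide (x ∈ L) = b x := by
      have := hb x
      cases h : b x <;> simp_all
    unfold Turing.haltList
    congr 1
    funext i
    by_cases hi : i = (1 : Fin (p.maxStack + 2))
    · subst hi
      simp [machine, hbx, Computability.encodeBool]
      rfl
    · have : Fin.val (n := p.maxStack + 2) i ≠ 1 := fun h => hi (Fin.ext (by simpa using h))
      rw [update_of_ne this]
      exact dif_neg hi
  refine Eq.trans ?_ (congrArg some e2.symm)
  erw [e1]
  erw [hs]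
  rfl

end Prog

/-! ### Timed runs of stack programs -/

namespace Prog

open Function

/-- `p.RunsIn s s' t`: started with stack contents `s`, the program `p` ends with stack contents
`s'` after at most `t` elementary steps. -/
def RunsIn (p : Prog) (s s' : ℕ → List Bool) (t : ℕ) : Prop :=
  ∃ t' ≤ t, p.Runs s s' t'

theorem RunsIn.mono {p : Prog} {s s' t t'} (h : p.RunsIn s s' t) (ht : t ≤ t') :
    p.RunsIn s s' t' :=
  let ⟨u, hu, hr⟩ := h
  ⟨u, hu.trans ht, hr⟩

theorem RunsIn.of_eq {p : Prog} {s s₁ s' t t'} (h : p.RunsIn s s₁ t) (hs : s₁ = s')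
    (ht : t ≤ t') : p.RunsIn s s' t' :=
  hs ▸ h.mono ht

theorem RunsIn.seq {p q : Prog} {s₁ s₂ s₃ t₁ t₂} (h₁ : p.RunsIn s₁ s₂ t₁)
    (h₂ : q.RunsIn s₂ s₃ t₂) : (p.seq q).RunsIn s₁ s₃ (t₁ + t₂) :=
  let ⟨_, hu, hr⟩ := h₁
  let ⟨_, hu', hr'⟩ := h₂
  ⟨_, add_le_add hu hu', hr.seq hr'⟩

theorem RunsIn.skip (s) : skip.RunsIn s s 1 := ⟨1, le_rfl, .skip s⟩

theorem RunsIn.push (k b) (s : ℕ → List Bool) :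
    (push k b).RunsIn s (update s k (b :: s k)) 1 := ⟨1, le_rfl, .push k b s⟩

theorem RunsIn.pop (k) (s : ℕ → List Bool) :
    (pop k).RunsIn s (update s k (s k).tail) 1 := ⟨1, le_rfl, .pop k s⟩

theorem RunsIn.cases_nil {k p q r s s' t} (h : s k = []) (h' : p.RunsIn s s' t) :
    (cases k p q r).RunsIn s s' (t + 1) :=
  let ⟨_, hu, hr⟩ := h'
  ⟨_, Nat.succ_le_succ hu, .cases_nil h hr⟩

theorem RunsIn.cases_false {k p q r s s' t l} (h : s k = false :: l) (h' : q.RunsIn s s' t) :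
    (cases k p q r).RunsIn s s' (t + 1) :=
  let ⟨_, hu, hr⟩ := h'
  ⟨_, Nat.succ_le_succ hu, .cases_false h hr⟩

theorem RunsIn.cases_true {k p q r s s' t l} (h : s k = true :: l) (h' : r.RunsIn s s' t) :
    (cases k p q r).RunsIn s s' (t + 1) :=
  let ⟨_, hu, hr⟩ := h'
  ⟨_, Nat.succ_le_succ hu, .cases_true h hr⟩

theorem RunsIn.loop_nil {k p} {s : ℕ → List Bool} (h : s k = []) : (loop k p).RunsIn s s 1 :=
  ⟨1, le_rfl, .loop_nil h⟩

theorem RunsIn.loop_cons {k p s₁ s₂ s₃ t₁ t₂} (h : s₁ k ≠ []) (h₁ : RunsIn p s₁ s₂ t₁)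
    (h₂ : (loop k p).RunsIn s₂ s₃ t₂) : (loop k p).RunsIn s₁ s₃ (t₁ + t₂ + 1) :=
  let ⟨_, hu, hr⟩ := h₁
  let ⟨_, hu', hr'⟩ := h₂
  ⟨_, by gcongr, .loop_cons h hr hr'⟩

/-- Empty a stack. -/
def clear (k : ℕ) : Prog := loop k (pop k)

theorem clear_runsIn (k : ℕ) (s : ℕ → List Bool) :
    (clear k).RunsIn s (update s k []) (2 * (s k).length + 1) := by
  generalize hl : s k = l
  induction l generalizing s with
  | nil => exact (RunsIn.loop_nil hl).of_eq (by rw [← hl, update_eq_self]) le_rfl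
  | cons b l ih =>
    have h := ih (update s k (s k).tail) (by simp [hl])
    rw [update_idem] at h
    refine (RunsIn.loop_cons (by simp [hl]) (RunsIn.pop k s) h).mono ?_
    simp only [List.length_cons]
    omega

/-- Move the content of stack `k` to stack `k'`, symbol by symbol. -/
def move (k k' : ℕ) : Prog :=
  loop k (cases k skip (seq (pop k) (push k' false)) (seq (pop k) (push k' true)))

theorem pop_push_runsIn {k k' : ℕ} {s : ℕ → List Bool} {b : Bool} {l : List Bool}
    (hkk : k ≠ k') (hk : s k = b :: l) :
    (seq (pop k) (push k' b)).RunsIn s (update (update s k l) k' (b :: s k')) 2 := by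
  have h := (RunsIn.pop k s).seq (RunsIn.push k' b _)
  rwa [hk, update_of_ne hkk.symm, List.tail_cons] at h

theorem cases_pop_push_runsIn {k k' : ℕ} {s : ℕ → List Bool} {b : Bool} {l : List Bool}
    (hkk : k ≠ k') (hk : s k = b :: l) :
    (cases k skip (seq (pop k) (push k' false)) (seq (pop k) (push k' true))).RunsIn s
      (update (update s k l) k' (b :: s k')) 3 := by
  cases b with
  | false => exact .cases_false hk (pop_push_runsIn hkk hk)
  | true => exact .cases_true hk (pop_push_runsIn hkk hk)

theorem move_runsIn {k k' : ℕ} (hkk : k ≠ k') (s : ℕ → List Bool) :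
    (move k k').RunsIn s (update (update s k []) k' ((s k).reverse ++ s k'))
      (4 * (s k).length + 1) := by
  generalize hl : s k = l
  induction l generalizing s with
  | nil => exact (RunsIn.loop_nil hl).of_eq (by rw [← hl, update_eq_self, hl]; simp) le_rfl
  | cons b l ih =>
    have h := ih (update (update s k l) k' (b :: s k')) (by simp [update_of_ne hkk])
    have e : update (update (update (update s k l) k' (b :: s k')) k [])
        k' (l.reverse ++ update (update s k l) k' (b :: s k') k') =
        update (update s k []) k' ((b :: l).reverse ++ s k') := by
      rw [update_self, update_comm hkk.symm, update_idem, update_idem]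
      simp
    rw [e] at h
    refine (RunsIn.loop_cons (by simp [hl]) (cases_pop_push_runsIn hkk hl) h).mono ?_
    simp only [List.length_cons]
    omega

end Prog

/-! ### A term language for functions on natural numbers -/

/-- The data on which terms are evaluated: the input word, the table of bits computed so far (the
newest bit first), and the values of the variables. -/
structure Ctx where
  /-- the input word -/
  inp : List Bool
  /-- the table, newest bit first -/
  tab : List Bool
  /-- the values of the variables, in de Bruijn style -/
  v : ℕ → ℕ

namespace Ctx

open Function

/-- Add a variable, with index `0`. -/
def push (e : Ctx) (x : ℕ) : Ctx where
  inp := e.inp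
  tab := e.tab
  v := fun i => match i with
    | 0 => x
    | i + 1 => e.v i

/-- Drop the variable with index `0`. -/
def pop (e : Ctx) : Ctx where
  inp := e.inp
  tab := e.tab
  v := fun i => e.v (i + 1)

/-- The stack contents that represent a context with `d` variables: the input word on stack `0`, the
table on stack `1`, and above them the variables in unary, the most recent one on the last stack. -/
def store (d : ℕ) (e : Ctx) : ℕ → List Bool
  | 0 => e.inp
  | 1 => e.tab
  | k + 2 => if k < d then List.replicate (e.v (d - 1 - k)) true else []

theorem store_of_le {d k : ℕ} (e : Ctx) (h : d + 2 ≤ k) : e.store d k = [] := by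
  obtain ⟨k, rfl⟩ := Nat.exists_eq_add_of_le' (show 2 ≤ k by omega)
  simp [store, show ¬ k < d by omega]

theorem store_push (d : ℕ) (e : Ctx) (x : ℕ) :
    (e.push x).store (d + 1) = update (e.store d) (d + 2) (List.replicate x true) := by
  funext k
  match k with
  | 0 => rw [update_of_ne (by omega)]; rfl
  | 1 => rw [update_of_ne (by omega)]; rfl
  | k + 2 =>
    rcases lt_trichotomy k d with h | rfl | h
    · rw [update_of_ne (by omega)]
      have : d - k = d - 1 - k + 1 := by omega
      simp [store, push, h, show k < d + 1 by omega, this]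
    · simp [store, push]
    · rw [update_of_ne (by omega)]
      simp [store, show ¬ k < d + 1 by omega, show ¬ k < d by omega]

theorem store_push_zero (d : ℕ) (e : Ctx) : (e.push 0).store (d + 1) = e.store d := by
  rw [store_push, List.replicate_zero, update_eq_self_iff, store_of_le e le_rfl]

theorem store_push_push (d : ℕ) (e : Ctx) (x y : ℕ) :
    ((e.push x).push y).store (d + 2) =
      update (update (e.store d) (d + 2) (List.replicate x true)) (d + 3)
        (List.replicate y true) := by
  rw [store_push, store_push]

end Ctx

/-- Iterate `f` on an accumulator, with an index running down from `n - 1` to `0`. -/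
def downFold (f : ℕ → ℕ → ℕ) : ℕ → ℕ → ℕ
  | 0, acc => acc
  | n + 1, acc => downFold f n (f acc n)

/-- The time for carrying out `downFold f`, when the step with accumulator `acc` and index `n` takes
time `c acc n`. -/
def downCost (f c : ℕ → ℕ → ℕ) : ℕ → ℕ → ℕ
  | 0, acc => 4 * acc + 2
  | n + 1, acc => c acc n + 2 * acc + 4 * f acc n + 4 + downCost f c n (f acc n)

/-- Terms. The term `ite c a b` has the value of `b` if `c` is zero and that of `a` otherwise;
`iter n a b` iterates `b` on the accumulator (variable `0`) with an index (variable `1`) that runs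
down to `0`, starting with the value of `a`, for which variable `0` is the number of iterations;
`read o t` looks up a symbol of the input word (`o = false`) or the table (`o = true`), and `len o`
is the length of that word. -/
inductive Tm : Type
  | var (i : ℕ)
  | zero
  | succ (t : Tm)
  | pred (t : Tm)
  | ite (c a b : Tm)
  | iter (n a b : Tm)
  | read (o : Bool) (t : Tm)
  | len (o : Bool)

namespace Tm

open Function Prog

/-- The words that can be looked up. -/
def word (e : Ctx) : Bool → List Bool
  | false => e.inp
  | true => e.tab

/-- The value of a look-up: `0` beyond the end of the word, `1` for `false`, `2` for `true`. -/
def symbol : Option Bool → ℕ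
  | none => 0
  | some false => 1
  | some true => 2

/-- The value of a term. -/
def eval : Tm → Ctx → ℕ
  | var i, e => e.v i
  | zero, _ => 0
  | succ t, e => t.eval e + 1
  | pred t, e => t.eval e - 1
  | ite c a b, e => if c.eval e = 0 then b.eval e else a.eval e
  | iter n a b, e => downFold (fun acc i => b.eval ((e.push i).push acc)) (n.eval e)
      (a.eval (e.push (n.eval e)))
  | read o t, e => symbol (word e o)[t.eval e]?
  | len o, e => (word e o).length

/-- A bound for the time that the evaluation of a term takes. -/
def cost : Tm → Ctx → ℕ
  | var i, e => 8 * e.v i + 2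
  | zero, _ => 1
  | succ t, e => t.cost e + 1
  | pred t, e => t.cost e + 1
  | ite c a b, e => c.cost e + 2 * c.eval e + 2 + if c.eval e = 0 then b.cost e else a.cost e
  | iter n a b, e => n.cost e + a.cost (e.push (n.eval e)) +
      downCost (fun acc i => b.eval ((e.push i).push acc))
        (fun acc i => b.cost ((e.push i).push acc)) (n.eval e) (a.eval (e.push (n.eval e)))
  | read _ t, e => t.cost e + 9 * t.eval e + 5
  | len o, e => 9 * (word e o).length + 2

/-- The program that evaluates a term in a context with `d` variables: it leaves the value, as a
new variable, on stack `d + 2`. All other stacks are restored; variables with an index of at least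
`d` count as zero. The look-ups move the front part of the word to stack `d + 3` and back. -/
def comp : Tm → ℕ → Prog
  | var i, d =>
    if i < d then
      seq (loop (d + 1 - i)
        (seq (pop (d + 1 - i)) (seq (push (d + 2) true) (push (d + 3) true))))
        (move (d + 3) (d + 1 - i))
    else skip
  | zero, _ => skip
  | succ t, d => seq (t.comp d) (push (d + 2) true)
  | pred t, d => seq (t.comp d) (pop (d + 2))
  | ite c a b, d =>
    seq (c.comp d) (cases (d + 2) (b.comp d) skip (seq (clear (d + 2)) (a.comp d)))
  | iter n a b, d =>
    seq (n.comp d) <| seq (a.comp (d + 1)) <|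
      seq (loop (d + 2) (seq (pop (d + 2)) (seq (b.comp (d + 2))
        (seq (clear (d + 3)) (move (d + 4) (d + 3)))))) (move (d + 3) (d + 2))
  | read o t, d =>
    seq (t.comp d) <|
      seq (loop (d + 2) (seq (pop (d + 2)) (cases o.toNat skip
        (seq (pop o.toNat) (push (d + 3) false)) (seq (pop o.toNat) (push (d + 3) true))))) <|
      seq (cases o.toNat skip (push (d + 2) true) (seq (push (d + 2) true) (push (d + 2) true)))
        (move (d + 3) o.toNat)
  | len o, d =>
    seq (loop o.toNat (seq (push (d + 2) true) (cases o.toNat skip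
      (seq (pop o.toNat) (push (d + 3) false)) (seq (pop o.toNat) (push (d + 3) true)))))
      (move (d + 3) o.toNat)

/-- Copy a number from stack `k` to stack `a`, by way of the auxiliary stack `b`. -/
theorem copy_runsIn {k a b : ℕ} (hka : k ≠ a) (hkb : k ≠ b) (hab : a ≠ b) (s : ℕ → List Bool)
    (n : ℕ) (hk : s k = List.replicate n true) (ha : s a = []) (hb : s b = []) :
    (seq (loop k (seq (pop k) (seq (push a true) (push b true)))) (move b k)).RunsIn s
      (update s a (List.replicate n true)) (8 * n + 2) := by
  have key : ∀ n (s : ℕ → List Bool), s k = List.replicate n true →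
      (loop k (seq (Prog.pop k) (seq (Prog.push a true) (Prog.push b true)))).RunsIn s
        (update (update (update s k []) a (List.replicate n true ++ s a)) b
          (List.replicate n true ++ s b)) (4 * n + 1) := by
    intro n
    induction n with
    | zero =>
      intro s hk
      exact (RunsIn.loop_nil hk).of_eq
        (by rw [show [] = s k from hk.symm, update_eq_self]; simp) le_rfl
    | succ n ih =>
      intro s hk
      have h := (RunsIn.pop k s).seq ((RunsIn.push a true _).seq (RunsIn.push b true _))
      have h' := ih (update (update (update s k (s k).tail) a
        (true :: update s k (s k).tail a)) b (true :: update (update s k (s k).tail) a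
        (true :: update s k (s k).tail a) b)) (by
        rw [update_of_ne hkb, update_of_ne hka, update_self, hk]; rfl)
      refine (RunsIn.loop_cons (by rw [hk]; simp) h h').of_eq ?_ (by omega)
      funext i
      simp only [update_apply]
      split_ifs <;> simp_all [List.replicate_succ', List.append_assoc]
  have h := (key n s hk).seq (move_runsIn hkb.symm _)
  refine h.of_eq ?_ (by simp [hb]; omega)
  funext i
  simp only [update_apply]
  split_ifs <;> simp_all

/-- Move as many symbols from stack `k` to stack `b` as stack `a` says. -/
theorem take_runsIn {k a b : ℕ} (hka : k ≠ a) (hkb : k ≠ b) (hab : a ≠ b) (n : ℕ)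
    (s : ℕ → List Bool) (ha : s a = List.replicate n true) :
    (loop a (seq (pop a) (cases k skip (seq (pop k) (push b false))
      (seq (pop k) (push b true))))).RunsIn s
      (update (update (update s a []) k ((s k).drop n)) b (((s k).take n).reverse ++ s b))
      (5 * n + 1) := by
  induction n generalizing s with
  | zero =>
    exact (RunsIn.loop_nil ha).of_eq
      (by rw [show [] = s a from ha.symm, update_eq_self]; simp) le_rfl
  | succ n ih =>
    have hpop := RunsIn.pop a s
    rw [ha, List.replicate_succ, List.tail_cons] at hpop
    set s₁ := update s a (List.replicate n true) with hs₁
    cases hl : s k with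
    | nil =>
      have h₁ : s₁ k = [] := by rw [hs₁, update_of_ne hka, hl]
      have h := hpop.seq (RunsIn.cases_nil (q := seq (Prog.pop k) (Prog.push b false))
        (r := seq (Prog.pop k) (Prog.push b true)) h₁ (RunsIn.skip _))
      have h' := ih s₁ (by rw [hs₁, update_self])
      refine (RunsIn.loop_cons (by rw [ha]; simp) h h').of_eq ?_ (by omega)
      funext i
      simp only [update_apply, hs₁]
      split_ifs <;> simp_all
    | cons c l =>
      have h₁ : s₁ k = c :: l := by rw [hs₁, update_of_ne hka, hl]
      have h := hpop.seq (cases_pop_push_runsIn hkb h₁)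
      have h' := ih (update (update s₁ k l) b (c :: s₁ b)) (by
        rw [update_of_ne hab, update_of_ne hka.symm, hs₁, update_self])
      refine (RunsIn.loop_cons (by rw [ha]; simp) h h').of_eq ?_ (by omega)
      funext i
      simp only [update_apply, hs₁]
      split_ifs <;> simp_all

/-- Move stack `k` to stack `b` and write the number of its symbols on stack `a`. -/
theorem count_runsIn {k a b : ℕ} (hka : k ≠ a) (hkb : k ≠ b) (hab : a ≠ b) (l : List Bool)
    (s : ℕ → List Bool) (hk : s k = l) :
    (loop k (seq (push a true) (cases k skip (seq (pop k) (push b false))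
      (seq (pop k) (push b true))))).RunsIn s
      (update (update (update s k []) a (List.replicate l.length true ++ s a)) b
        (l.reverse ++ s b)) (5 * l.length + 1) := by
  induction l generalizing s with
  | nil =>
    exact (RunsIn.loop_nil hk).of_eq (by rw [← hk, update_eq_self, hk]; simp) le_rfl
  | cons c l ih =>
    have h₁ : update s a (true :: s a) k = c :: l := by rw [update_of_ne hka, hk]
    have h := (RunsIn.push a true s).seq (cases_pop_push_runsIn hkb h₁)
    have h' := ih (update (update (update s a (true :: s a)) k l) b
      (c :: update s a (true :: s a) b)) (by
      rw [update_of_ne hkb, update_self])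
    refine (RunsIn.loop_cons (by rw [hk]; simp) h h').of_eq ?_
      (by simp only [List.length_cons]; omega)
    funext i
    simp only [update_apply]
    split_ifs <;> simp_all [List.replicate_succ', List.append_assoc]

theorem store_word (d : ℕ) (e : Ctx) (o : Bool) : e.store d o.toNat = word e o := by
  cases o <;> rfl

/-- Compiled terms compute the value of the term within the time bound. -/
theorem comp_runsIn (t : Tm) (d : ℕ) (e : Ctx) (he : ∀ i, d ≤ i → e.v i = 0) :
    (t.comp d).RunsIn (e.store d) ((e.push (t.eval e)).store (d + 1)) (t.cost e) := by
  have hpush : ∀ {d : ℕ} {e : Ctx} (x : ℕ), (∀ i, d ≤ i → e.v i = 0) →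
      ∀ i, d + 1 ≤ i → (e.push x).v i = 0 := by
    intro d e x he i hi
    obtain ⟨i, rfl⟩ := Nat.exists_eq_add_of_le' (show 1 ≤ i by omega)
    exact he i (by omega)
  induction t generalizing d e with
  | var i =>
    rw [Ctx.store_push]
    simp only [comp, eval, cost]
    split_ifs with hi
    · refine copy_runsIn (by omega) (by omega) (by omega) _ _ ?_ (e.store_of_le le_rfl)
        (e.store_of_le (by omega))
      obtain ⟨j, hj⟩ := Nat.exists_eq_add_of_le (show i + 1 ≤ d by omega)
      have : d + 1 - i = j + 2 := by omega
      rw [this, Ctx.store, if_pos (by omega)]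
      congr 2
      omega
    · rw [he i (by omega), List.replicate_zero, ← e.store_of_le (d := d) le_rfl, update_eq_self]
      exact (RunsIn.skip _).mono (by omega)
  | zero =>
    rw [eval, Ctx.store_push_zero]
    exact RunsIn.skip _
  | succ t ih =>
    refine ((ih d e he).seq (RunsIn.push (d + 2) true _)).of_eq ?_ le_rfl
    rw [Ctx.store_push, Ctx.store_push, update_self, update_idem]
    rfl
  | pred t ih =>
    refine ((ih d e he).seq (RunsIn.pop (d + 2) _)).of_eq ?_ le_rfl
    rw [Ctx.store_push, Ctx.store_push, update_self, update_idem, List.tail_replicate]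
    rfl
  | ite c a b ihc iha ihb =>
    have h := ihc d e he
    by_cases hc : c.eval e = 0
    · rw [hc, Ctx.store_push_zero] at h
      have h1 := h.seq (RunsIn.cases_nil (q := skip)
        (r := seq (clear (d + 2)) (a.comp d)) (e.store_of_le le_rfl) (ihb d e he))
      refine h1.of_eq ?_ ?_
      · simp only [eval, hc, if_true]
      · simp only [cost, hc, if_true]
        omega
    · obtain ⟨n, hn⟩ := Nat.exists_eq_succ_of_ne_zero hc
      have h2 : (e.push (c.eval e)).store (d + 1) (d + 2) = List.replicate (n + 1) true := by
        rw [Ctx.store_push, update_self, hn]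
      have h1 := clear_runsIn (d + 2) ((e.push (c.eval e)).store (d + 1))
      have e1 : update ((e.push (c.eval e)).store (d + 1)) (d + 2) [] = e.store d := by
        rw [Ctx.store_push, update_idem, update_eq_self_iff, e.store_of_le le_rfl]
      rw [h2, e1] at h1
      rw [List.replicate_succ] at h2
      refine (h.seq (RunsIn.cases_true h2 (h1.seq (iha d e he)))).of_eq ?_ ?_
      · simp only [eval, hc, if_false]
      · simp only [cost, hc, if_false, List.length_replicate]
        omega
  | iter n a b ihn iha ihb =>
    have hloop : ∀ k acc, (seq (loop (d + 2) (seq (Prog.pop (d + 2)) (seq (b.comp (d + 2))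
        (seq (clear (d + 3)) (move (d + 4) (d + 3)))))) (move (d + 3) (d + 2))).RunsIn
        (((e.push k).push acc).store (d + 2))
        ((e.push (downFold (fun acc i => b.eval ((e.push i).push acc)) k acc)).store (d + 1))
        (downCost (fun acc i => b.eval ((e.push i).push acc))
          (fun acc i => b.cost ((e.push i).push acc)) k acc) := by
      intro k
      induction k with
      | zero =>
        intro acc
        have h0 : ((e.push 0).push acc).store (d + 2) (d + 2) = [] := by
          rw [Ctx.store_push_push, update_of_ne (by omega), update_self]
          rfl
        refine ((RunsIn.loop_nil h0).seq (move_runsIn (show d + 3 ≠ d + 2 by omega) _)).of_eq ?_ ?_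
        · rw [Ctx.store_push_push, Ctx.store_push]
          have h3 := e.store_of_le (d := d) (k := d + 3) (by omega)
          funext i
          simp only [update_apply, downFold]
          split_ifs <;> simp_all
        · rw [Ctx.store_push_push, update_self]
          simp only [List.length_replicate, downCost]
          omega
      | succ k ih =>
        intro acc
        obtain ⟨x, hx⟩ : ∃ x, x = b.eval ((e.push k).push acc) := ⟨_, rfl⟩
        have h1 := RunsIn.pop (d + 2) (((e.push (k + 1)).push acc).store (d + 2))
        have e1 : update (((e.push (k + 1)).push acc).store (d + 2)) (d + 2)
            ((((e.push (k + 1)).push acc).store (d + 2)) (d + 2)).tail =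
            ((e.push k).push acc).store (d + 2) := by
          rw [Ctx.store_push_push, Ctx.store_push_push]
          funext i
          simp only [update_apply]
          split_ifs <;> simp_all [List.replicate_succ]
        rw [e1] at h1
        have h2 := ihb (d + 2) ((e.push k).push acc) (hpush _ (hpush _ he))
        rw [← hx] at h2
        have h3 := clear_runsIn (d + 3) ((((e.push k).push acc).push x).store (d + 3))
        have h4 := move_runsIn (show d + 4 ≠ d + 3 by omega) (update
          ((((e.push k).push acc).push x).store (d + 3)) (d + 3) [])
        have e4 : update (update (update
            ((((e.push k).push acc).push x).store (d + 3)) (d + 3) []) (d + 4) []) (d + 3)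
            ((update ((((e.push k).push acc).push x).store (d + 3)) (d + 3) [] (d + 4)).reverse ++
            update ((((e.push k).push acc).push x).store (d + 3)) (d + 3) [] (d + 3)) =
            ((e.push k).push x).store (d + 2) := by
          rw [Ctx.store_push, Ctx.store_push_push, Ctx.store_push_push]
          have h4 := e.store_of_le (d := d) (k := d + 4) (by omega)
          funext i
          simp only [update_apply]
          split_ifs <;> simp_all
        rw [e4] at h4
        have h5 := ih x
        obtain ⟨t₁, ht₁, hr₁⟩ := h1.seq (h2.seq (h3.seq h4))
        obtain ⟨t₂, ht₂, hr₂⟩ := h5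
        cases hr₂ with
        | seq hr₂ hr₃ =>
          have hne : ((e.push (k + 1)).push acc).store (d + 2) (d + 2) ≠ [] := by
            rw [Ctx.store_push_push, update_of_ne (by omega), update_self]
            simp [List.replicate_succ]
          refine RunsIn.of_eq ⟨_, le_rfl, (Runs.loop_cons hne hr₁ hr₂).seq hr₃⟩ ?_ ?_
          · simp only [downFold, ← hx]
          · have l1 : ((((e.push k).push acc).push x).store (d + 3) (d + 3)).length = acc := by
              rw [Ctx.store_push, Ctx.store_push_push, update_of_ne (by omega), update_self]
              simp
            have l2 : (update ((((e.push k).push acc).push x).store (d + 3)) (d + 3) []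
                (d + 4)).length = x := by
              rw [Ctx.store_push, update_of_ne (by omega), update_self]
              simp
            rw [l1, l2] at ht₁
            simp only [downCost, ← hx]
            omega
    have h := (ihn d e he).seq ((iha (d + 1) _ (hpush _ he)).seq (hloop _ _))
    exact h.mono (le_of_eq (by simp only [cost]; omega))
  | read o t ih =>
    have ho : o.toNat ≤ 1 := Bool.toNat_le o
    obtain ⟨n, hn⟩ : ∃ n, n = t.eval e := ⟨_, rfl⟩
    have h := ih d e he
    have h1 := take_runsIn (k := o.toNat) (a := d + 2) (b := d + 3) (by omega) (by omega)
      (by omega) n ((e.push n).store (d + 1)) (by rw [Ctx.store_push, update_self])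
    rw [← hn] at h
    have e1 : update (update (update ((e.push n).store (d + 1)) (d + 2) []) o.toNat
        (((e.push n).store (d + 1) o.toNat).drop n)) (d + 3)
        ((((e.push n).store (d + 1) o.toNat).take n).reverse ++ (e.push n).store (d + 1) (d + 3)) =
        update (update (e.store d) o.toNat ((word e o).drop n)) (d + 3)
          ((word e o).take n).reverse := by
      rw [Ctx.store_push, update_of_ne (a := o.toNat) (by omega), store_word,
        update_of_ne (a := d + 3) (by omega), e.store_of_le (show d + 2 ≤ d + 3 by omega),
        update_idem, ← e.store_of_le (d := d) le_rfl, update_eq_self,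
        e.store_of_le (d := d) le_rfl, List.append_nil]
    rw [e1] at h1
    set s₁ := update (update (e.store d) o.toNat ((word e o).drop n)) (d + 3)
      ((word e o).take n).reverse with hs₁
    have hs : s₁ o.toNat = (word e o).drop n := by
      rw [hs₁, update_of_ne (by omega), update_self]
    have h2s : s₁ (d + 2) = [] := by
      rw [hs₁, update_of_ne (by omega), update_of_ne (by omega), e.store_of_le le_rfl]
    have h2 : (cases o.toNat skip (Prog.push (d + 2) true)
        (seq (Prog.push (d + 2) true) (Prog.push (d + 2) true))).RunsIn s₁
        (update s₁ (d + 2) (List.replicate (symbol (word e o)[n]?) true)) 3 := by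
      rw [← List.head?_drop, ← hs]
      cases hl : s₁ o.toNat with
      | nil =>
        refine (RunsIn.cases_nil hl ?_).mono (by omega : 1 + 1 ≤ 3)
        have : update s₁ (d + 2) (List.replicate (symbol [].head?) true) = s₁ := by
          rw [update_eq_self_iff, h2s]
          rfl
        rw [this]
        exact RunsIn.skip _
      | cons c l =>
        cases c with
        | false =>
          refine (RunsIn.cases_false hl ?_).mono (by omega : 1 + 1 ≤ 3)
          have := RunsIn.push (d + 2) true s₁
          rwa [h2s] at this
        | true =>
          refine (RunsIn.cases_true hl ?_).mono (by omega : 2 + 1 ≤ 3)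
          have := (RunsIn.push (d + 2) true s₁).seq (RunsIn.push (d + 2) true _)
          rwa [update_self, h2s, update_idem] at this
    have h3 := move_runsIn (show d + 3 ≠ o.toNat by omega)
      (update s₁ (d + 2) (List.replicate (symbol (word e o)[n]?) true))
    have e3 : update (update (update s₁ (d + 2) (List.replicate (symbol (word e o)[n]?) true))
        (d + 3) []) o.toNat
        (((update s₁ (d + 2) (List.replicate (symbol (word e o)[n]?) true)) (d + 3)).reverse ++
        (update s₁ (d + 2) (List.replicate (symbol (word e o)[n]?) true)) o.toNat) =
        (e.push ((read o t).eval e)).store (d + 1) := by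
      rw [update_of_ne (a := o.toNat) (by omega), update_of_ne (a := d + 3) (by omega), hs, hs₁,
        update_self, List.reverse_reverse, List.take_append_drop, Ctx.store_push, eval, ← hn,
        ← store_word d e o]
      have h3 := e.store_of_le (d := d) (k := d + 3) (by omega)
      funext i
      simp only [update_apply]
      split_ifs <;> first | rfl | omega | simp_all
    rw [e3] at h3
    refine (h.seq (h1.seq (h2.seq h3))).mono ?_
    have l3 : (update s₁ (d + 2) (List.replicate (symbol (word e o)[n]?) true)
        (d + 3)).length ≤ n := by
      rw [update_of_ne (by omega), hs₁, update_self]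
      simp
    simp only [cost, ← hn]
    omega
  | len o =>
    have ho : o.toNat ≤ 1 := Bool.toNat_le o
    have h1 := count_runsIn (k := o.toNat) (a := d + 2) (b := d + 3) (by omega) (by omega)
      (by omega) (word e o) (e.store d) (store_word d e o)
    rw [e.store_of_le le_rfl, e.store_of_le (show d + 2 ≤ d + 3 by omega), List.append_nil,
      List.append_nil] at h1
    have h2 := move_runsIn (show d + 3 ≠ o.toNat by omega) (update (update
      (update (e.store d) o.toNat []) (d + 2) (List.replicate (word e o).length true)) (d + 3)
      (word e o).reverse)
    refine (h1.seq h2).of_eq ?_ ?_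
    · rw [Ctx.store_push, update_self, update_of_ne (a := o.toNat) (by omega),
        update_of_ne (a := o.toNat) (by omega), update_self, List.reverse_reverse,
        List.append_nil, eval, ← store_word d e o]
      have h3 := e.store_of_le (d := d) (k := d + 3) (by omega)
      funext i
      simp only [update_apply]
      split_ifs <;> first | rfl | omega | simp_all
    · rw [update_self, List.length_reverse]
      simp only [cost]
      omega

end Tm

/-! ### Functions with polynomially bounded evaluation -/

namespace Ctx

/-- `M` bounds the lengths of the words and the values of the variables. -/
def Bdd (e : Ctx) (M : ℕ) : Prop :=
  e.inp.length ≤ M ∧ e.tab.length ≤ M ∧ ∀ i, e.v i ≤ M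

theorem Bdd.mono {e : Ctx} {M M' : ℕ} (h : e.Bdd M) (hM : M ≤ M') : e.Bdd M' :=
  ⟨h.1.trans hM, h.2.1.trans hM, fun i => (h.2.2 i).trans hM⟩

theorem Bdd.push {e : Ctx} {M x : ℕ} (h : e.Bdd M) (hx : x ≤ M) : (e.push x).Bdd M :=
  ⟨h.1, h.2.1, fun i => by
    cases i with
    | zero => exact hx
    | succ i => exact h.2.2 i⟩

/-- Rename the variables. -/
def ren (ρ : ℕ → ℕ) (e : Ctx) : Ctx where
  inp := e.inp
  tab := e.tab
  v := fun i => e.v (ρ i)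

theorem Bdd.ren {e : Ctx} {M : ℕ} (h : e.Bdd M) (ρ : ℕ → ℕ) : (e.ren ρ).Bdd M :=
  ⟨h.1, h.2.1, fun i => h.2.2 (ρ i)⟩

end Ctx

/-- Extend a renaming of variables to a context with one more variable. -/
def liftRen (ρ : ℕ → ℕ) : ℕ → ℕ
  | 0 => 0
  | i + 1 => ρ i + 1

theorem Ctx.ren_push (ρ : ℕ → ℕ) (e : Ctx) (x : ℕ) :
    (e.push x).ren (liftRen ρ) = (e.ren ρ).push x := by
  simp only [Ctx.ren, Ctx.push, Ctx.mk.injEq, true_and]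
  funext i
  cases i <;> rfl

namespace Tm

/-- Rename the variables of a term. -/
def ren : (ℕ → ℕ) → Tm → Tm
  | ρ, var i => var (ρ i)
  | _, zero => zero
  | ρ, succ t => succ (t.ren ρ)
  | ρ, pred t => pred (t.ren ρ)
  | ρ, ite c a b => ite (c.ren ρ) (a.ren ρ) (b.ren ρ)
  | ρ, iter n a b => iter (n.ren ρ) (a.ren (liftRen ρ)) (b.ren (liftRen (liftRen ρ)))
  | ρ, read o t => read o (t.ren ρ)
  | _, len o => len o

theorem eval_ren (t : Tm) (ρ : ℕ → ℕ) (e : Ctx) : (t.ren ρ).eval e = t.eval (e.ren ρ) := by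
  induction t generalizing ρ e with
  | var i => rfl
  | zero => rfl
  | succ t ih => simp only [ren, eval, ih]
  | pred t ih => simp only [ren, eval, ih]
  | ite c a b ihc iha ihb => simp only [ren, eval, ihc, iha, ihb]
  | iter n a b ihn iha ihb => simp only [ren, eval, ihn, iha, ihb, Ctx.ren_push]
  | read o t ih => cases o <;> simp only [ren, eval, ih] <;> rfl
  | len o => cases o <;> rfl

theorem cost_ren (t : Tm) (ρ : ℕ → ℕ) (e : Ctx) : (t.ren ρ).cost e = t.cost (e.ren ρ) := by
  induction t generalizing ρ e with
  | var i => rfl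
  | zero => rfl
  | succ t ih => simp only [ren, cost, ih]
  | pred t ih => simp only [ren, cost, ih]
  | ite c a b ihc iha ihb => simp only [ren, cost, ihc, iha, ihb, eval_ren]
  | iter n a b ihn iha ihb => simp only [ren, cost, ihn, iha, ihb, Ctx.ren_push, eval_ren]
  | read o t ih => simp only [ren, cost, ih, eval_ren]
  | len o => cases o <;> rfl

end Tm

/-- Functions bounded by a polynomial in a common bound for the data of the context. -/
def PolyBdd (g : Ctx → ℕ) : Prop :=
  ∃ c, ∀ (e : Ctx) (M : ℕ), e.Bdd M → g e ≤ (M + 2) ^ c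

namespace PolyBdd

variable {f g : Ctx → ℕ}

theorem mono (hg : PolyBdd g) (h : ∀ e, f e ≤ g e) : PolyBdd f :=
  let ⟨c, hc⟩ := hg
  ⟨c, fun e M he => (h e).trans (hc e M he)⟩

theorem const (n : ℕ) : PolyBdd fun _ => n :=
  ⟨n, fun _ _ _ => (Nat.lt_two_pow_self (n := n)).le.trans (Nat.pow_le_pow_left (by omega) n)⟩

theorem var (i : ℕ) : PolyBdd fun e => e.v i :=
  ⟨1, fun e M he => (he.2.2 i).trans (by rw [pow_one]; omega)⟩

theorem inp : PolyBdd fun e => e.inp.length :=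
  ⟨1, fun e M he => he.1.trans (by rw [pow_one]; omega)⟩

theorem tab : PolyBdd fun e => e.tab.length :=
  ⟨1, fun e M he => he.2.1.trans (by rw [pow_one]; omega)⟩

theorem mul (hf : PolyBdd f) (hg : PolyBdd g) : PolyBdd fun e => f e * g e :=
  let ⟨c, hc⟩ := hf
  let ⟨d, hd⟩ := hg
  ⟨c + d, fun e M he => by
    rw [pow_add]
    exact Nat.mul_le_mul (hc e M he) (hd e M he)⟩

theorem add (hf : PolyBdd f) (hg : PolyBdd g) : PolyBdd fun e => f e + g e := by
  obtain ⟨c, hc⟩ := hf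
  obtain ⟨d, hd⟩ := hg
  refine ⟨max c d + 1, fun e M he => ?_⟩
  have h1 := (hc e M he).trans (Nat.pow_le_pow_right (by omega) (le_max_left c d))
  have h2 := (hd e M he).trans (Nat.pow_le_pow_right (by omega) (le_max_right c d))
  rw [pow_succ]
  nlinarith

/-- Bounds for the new variables turn into a bound for functions of an extended context. -/
theorem push₂ {n : Ctx → ℕ} (hf : PolyBdd f) (hn : PolyBdd n) (hg : PolyBdd g) :
    ∃ h, PolyBdd h ∧ ∀ e i x, i ≤ n e → x ≤ g e → f ((e.push i).push x) ≤ h e := by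
  obtain ⟨a, ha⟩ := hn
  obtain ⟨b, hb⟩ := hg
  obtain ⟨c, hc⟩ := hf
  refine ⟨fun e => (Finset.range (n e + 1) ×ˢ Finset.range (g e + 1)).sup
    fun p => f ((e.push p.1).push p.2), ⟨(a + b + 3) * c, fun e M he => ?_⟩,
    fun e i x hi hx => Finset.le_sup (f := fun p : ℕ × ℕ => f ((e.push p.1).push p.2))
      (b := (i, x)) (by simp; omega)⟩
  refine Finset.sup_le fun p hp => ?_
  simp only [Finset.mem_product, Finset.mem_range] at hp
  have h1 : n e ≤ (M + 2) ^ (a + b + 1) :=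
    (ha e M he).trans (Nat.pow_le_pow_right (by omega) (by omega))
  have h2 : g e ≤ (M + 2) ^ (a + b + 1) :=
    (hb e M he).trans (Nat.pow_le_pow_right (by omega) (by omega))
  have h0 : M + 2 ≤ (M + 2) ^ (a + b + 1) := Nat.le_self_pow (by omega) _
  refine (hc _ ((M + 2) ^ (a + b + 1)) (((he.mono (by omega)).push ?_).push ?_)).trans ?_
  · omega
  · omega
  · rw [pow_mul]
    refine Nat.pow_le_pow_left ?_ c
    calc (M + 2) ^ (a + b + 1) + 2 ≤ (M + 2) ^ (a + b + 1) * 2 := by omega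
      _ ≤ (M + 2) ^ (a + b + 1) * (M + 2) ^ 2 :=
          Nat.mul_le_mul_left _ (by nlinarith [Nat.zero_le M])
      _ = (M + 2) ^ (a + b + 3) := by rw [← pow_add]

theorem ren (hf : PolyBdd f) (ρ : ℕ → ℕ) : PolyBdd fun e => f (e.ren ρ) :=
  let ⟨c, hc⟩ := hf
  ⟨c, fun _ _ he => hc _ _ (he.ren ρ)⟩

end PolyBdd

/-- An invariant of an iteration holds at its end. -/
theorem downFold_inv {f : ℕ → ℕ → ℕ} {I : ℕ → ℕ → Prop}
    (hI : ∀ i acc, I (i + 1) acc → I i (f acc i)) :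
    ∀ n acc, I n acc → I 0 (downFold f n acc)
  | 0, _, h => h
  | n + 1, acc, h => downFold_inv hI n _ (hI n acc h)

theorem downCost_le {f c : ℕ → ℕ → ℕ} {I : ℕ → ℕ → Prop} {G C : ℕ} :
    ∀ (n acc : ℕ), (∀ i acc, i < n → I (i + 1) acc → I i (f acc i)) →
      (∀ i acc, i ≤ n → I i acc → acc ≤ G) → (∀ i acc, i < n → acc ≤ G → c acc i ≤ C) → I n acc →
      downCost f c n acc ≤ n * (C + 6 * G + 4) + 4 * G + 2
  | 0, acc, _, hG, _, h => by
    have := hG 0 acc le_rfl h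
    simp only [downCost]
    omega
  | n + 1, acc, hI, hG, hC, h => by
    have h1 := hI n acc (Nat.lt_succ_self n) h
    have h2 := downCost_le n (f acc n) (fun i acc hi => hI i acc (by omega))
      (fun i acc hi => hG i acc (by omega)) (fun i acc hi => hC i acc (by omega)) h1
    have h3 := hG _ _ le_rfl h
    have h4 := hG n _ (Nat.le_succ n) h1
    have h5 := hC n acc (Nat.lt_succ_self n) h3
    simp only [downCost]
    rw [add_mul, one_mul]
    omega

/-- Functions that are values of a term, with polynomially bounded value and evaluation time. -/
def Cmp (f : Ctx → ℕ) : Prop :=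
  ∃ t : Tm, (∀ e, t.eval e = f e) ∧ PolyBdd f ∧ PolyBdd t.cost

open Classical in
/-- Decidable in polynomial time by a term. -/
def CmpP (p : Ctx → Prop) : Prop :=
  Cmp fun e => if p e then 1 else 0

namespace Cmp

variable {f g : Ctx → ℕ}

theorem var (i : ℕ) : Cmp fun e => e.v i :=
  ⟨.var i, fun _ => rfl, .var i, ((PolyBdd.const 8).mul (.var i)).add (.const 2)⟩

theorem zero : Cmp fun _ => 0 := ⟨.zero, fun _ => rfl, .const 0, .const 1⟩

theorem succ (hf : Cmp f) : Cmp fun e => f e + 1 :=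
  let ⟨t, ht, hv, hc⟩ := hf
  ⟨.succ t, fun e => by simp only [Tm.eval, ht], hv.add (.const 1), hc.add (.const 1)⟩

theorem pred (hf : Cmp f) : Cmp fun e => f e - 1 :=
  let ⟨t, ht, hv, hc⟩ := hf
  ⟨.pred t, fun e => by simp only [Tm.eval, ht], hv.mono fun _ => Nat.sub_le _ _,
    hc.add (.const 1)⟩

theorem const : ∀ n : ℕ, Cmp fun _ => n
  | 0 => zero
  | n + 1 => (const n).succ

theorem lenInp : Cmp fun e => e.inp.length :=
  ⟨.len false, fun _ => rfl, .inp, ((PolyBdd.const 9).mul .inp).add (.const 2)⟩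

theorem lenTab : Cmp fun e => e.tab.length :=
  ⟨.len true, fun _ => rfl, .tab, ((PolyBdd.const 9).mul .tab).add (.const 2)⟩

theorem symbol_le (o : Option Bool) : Tm.symbol o ≤ 2 := by
  rcases o with _ | _ | _ <;> simp [Tm.symbol]

theorem readInp (hf : Cmp f) : Cmp fun e => Tm.symbol e.inp[f e]? :=
  let ⟨t, ht, hv, hc⟩ := hf
  ⟨.read false t, fun e => by simp only [Tm.eval, ht, Tm.word],
    (PolyBdd.const 2).mono fun _ => symbol_le _,
    ((hc.add ((PolyBdd.const 9).mul hv)).add (.const 5)).mono fun e => by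
      simp only [Tm.cost, ht]; rfl⟩

theorem readTab (hf : Cmp f) : Cmp fun e => Tm.symbol e.tab[f e]? :=
  let ⟨t, ht, hv, hc⟩ := hf
  ⟨.read true t, fun e => by simp only [Tm.eval, ht, Tm.word],
    (PolyBdd.const 2).mono fun _ => symbol_le _,
    ((hc.add ((PolyBdd.const 9).mul hv)).add (.const 5)).mono fun e => by
      simp only [Tm.cost, ht]; rfl⟩

theorem ren (hf : Cmp f) (ρ : ℕ → ℕ) : Cmp fun e => f (e.ren ρ) :=
  let ⟨t, ht, hv, hc⟩ := hf
  ⟨t.ren ρ, fun e => by rw [Tm.eval_ren, ht], hv.ren ρ,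
    (hc.ren ρ).mono fun e => (t.cost_ren ρ e).le⟩

/-- Functions of the context without its last variable. -/
theorem pop (hf : Cmp f) : Cmp fun e => f e.pop := hf.ren Nat.succ

/-- Iterations whose accumulator stays polynomially bounded. The invariant `I e i x` says something
about the accumulator `x` when `i` steps are still to be done. -/
theorem iter {n a : Ctx → ℕ} {F : Ctx → ℕ → ℕ → ℕ} (hn : Cmp n) (ha : Cmp a)
    (hF : Cmp fun e => F e.pop.pop (e.v 0) (e.v 1)) (I : Ctx → ℕ → ℕ → Prop)
    (h0 : ∀ e, I e (n e) (a e)) (hI : ∀ e i x, I e (i + 1) x → I e i (F e x i))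
    (hg : PolyBdd g) (hIg : ∀ e i x, i ≤ n e → I e i x → x ≤ g e)
    (hf : ∀ e x, I e 0 x → x = f e) : Cmp f := by
  obtain ⟨tn, hn, hnv, hnc⟩ := hn
  obtain ⟨ta, ha, hav, hac⟩ := ha
  obtain ⟨tF, hF, hFv, hFc⟩ := hF
  have e1 : ∀ e x, (ta.ren Nat.succ).eval (e.push x) = a e := fun e x => by
    rw [Tm.eval_ren, ha]; rfl
  have e2 : ∀ e x, (ta.ren Nat.succ).cost (e.push x) = ta.cost e := fun e x => by
    rw [Tm.cost_ren]; rfl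
  have e3 : ∀ e : Ctx, (fun x i => tF.eval ((e.push i).push x)) = F e := fun e => by
    funext x i
    rw [hF]
    rfl
  have hres : ∀ e, downFold (F e) (n e) (a e) = f e := fun e =>
    hf e _ (downFold_inv (I := I e) (hI e) _ _ (h0 e))
  obtain ⟨C, hC, hCb⟩ := PolyBdd.push₂ hFc hnv hg
  refine ⟨.iter tn (ta.ren Nat.succ) tF, fun e => ?_, ?_, ?_⟩
  · simp only [Tm.eval, hn, e1, e3, hres]
  · refine hg.mono fun e => ?_
    rw [← hres]
    exact hIg e 0 _ (Nat.zero_le _) (downFold_inv (I := I e) (hI e) _ _ (h0 e))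
  · refine ((hnc.add hac).add (((hnv.mul ((hC.add ((PolyBdd.const 6).mul hg)).add
      (.const 4))).add ((PolyBdd.const 4).mul hg)).add (.const 2))).mono fun e => ?_
    simp only [Tm.cost, hn, e1, e2, e3]
    gcongr
    exact downCost_le (I := I e) _ _ (fun i x _ => hI e i x) (hIg e)
      (fun i x hi hx => hCb e i x hi.le hx) (h0 e)

theorem congr (hf : Cmp f) (h : ∀ e, f e = g e) : Cmp g := funext h ▸ hf

open Classical in
theorem ite {p : Ctx → Prop} [DecidablePred p] (hp : CmpP p) (hf : Cmp f) (hg : Cmp g) :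
    Cmp fun e => if p e then f e else g e := by
  obtain ⟨tp, hp, hpv, hpc⟩ := hp
  obtain ⟨tf, hf, hfv, hfc⟩ := hf
  obtain ⟨tg, hg, hgv, hgc⟩ := hg
  refine ⟨.ite tp tf tg, fun e => ?_, (hfv.add hgv).mono fun e => ?_,
    ((hpc.add (.const 4)).add (hfc.add hgc)).mono fun e => ?_⟩
  · by_cases h : p e <;> simp [Tm.eval, hp, hf, hg, h]
  · split_ifs <;> omega
  · simp only [Tm.cost, hp]
    split_ifs <;> omega

theorem add (hf : Cmp f) (hg : Cmp g) : Cmp fun e => f e + g e :=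
  iter (F := fun _ x _ => x + 1) hg hf (var 0).succ (fun e i x => x + i = f e + g e)
    (fun _ => rfl) (fun e i x h => by omega) (hf.choose_spec.2.1.add hg.choose_spec.2.1)
    (fun e i x _ h => by omega) (fun e x h => by omega)

theorem sub (hf : Cmp f) (hg : Cmp g) : Cmp fun e => f e - g e :=
  iter (F := fun _ x _ => x - 1) hg hf (var 0).pred
    (fun e i x => x ≤ f e ∧ x - i = f e - g e) (fun _ => ⟨le_rfl, rfl⟩)
    (fun e i x h => by omega) hf.choose_spec.2.1
    (fun e i x _ h => h.1) (fun e x h => by omega)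

/-- Bounded sums. -/
theorem sum {n : Ctx → ℕ} {F : Ctx → ℕ → ℕ} (hn : Cmp n) (hF : Cmp fun e => F e.pop (e.v 0)) :
    Cmp fun e => ∑ i ∈ Finset.range (n e), F e i := by
  obtain ⟨b, hb, hFb⟩ := PolyBdd.push₂ (hF.pop).choose_spec.2.1 hn.choose_spec.2.1 (.const 0)
  refine iter (F := fun e x i => x + F e i) hn zero ((var 0).add hF.pop)
    (fun e i x => x + ∑ j ∈ Finset.range i, F e j = ∑ j ∈ Finset.range (n e), F e j)
    (fun e => Nat.zero_add _) (fun e i x h => ?_)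
    (hn.choose_spec.2.1.mul hb) (fun e i x hi h => ?_) (fun e x h => by simpa using h)
  · rw [Finset.sum_range_succ] at h
    omega
  · refine le_trans (Nat.le.intro h) ?_
    refine (Finset.sum_le_card_nsmul _ _ (b e) fun i hi => ?_).trans (by simp)
    exact hFb e i 0 (Finset.mem_range.1 hi).le le_rfl

theorem mul (hf : Cmp f) (hg : Cmp g) : Cmp fun e => f e * g e :=
  (sum (F := fun e _ => g e) hf hg.pop).congr fun e => by simp

end Cmp

namespace CmpP

variable {f g : Ctx → ℕ} {p q : Ctx → Prop}

open Classical in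
theorem cmp [DecidablePred p] (hp : CmpP p) : Cmp fun e => if p e then 1 else 0 :=
  Cmp.ite hp (Cmp.const 1) (Cmp.const 0)

theorem congr (hp : CmpP p) (h : ∀ e, p e ↔ q e) : CmpP q := (funext fun e => propext (h e)) ▸ hp

theorem pop (hp : CmpP p) : CmpP fun e => p e.pop := Cmp.pop hp

theorem eq_zero (hf : Cmp f) : CmpP fun e => f e = 0 := by
  obtain ⟨t, ht, hv, hc⟩ := hf
  refine ⟨.ite t .zero (.succ .zero), fun e => ?_, (PolyBdd.const 1).mono fun e => ?_,
    ((hc.add ((PolyBdd.const 2).mul hv)).add (.const 4)).mono fun e => ?_⟩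
  · simp [Tm.eval, ht]
  · split_ifs <;> simp
  · simp only [Tm.cost, ht]
    split_ifs <;> omega

theorem not (hp : CmpP p) : CmpP fun e => ¬ p e :=
  (eq_zero hp).congr fun e => by simp

open Classical in
theorem and (hp : CmpP p) (hq : CmpP q) : CmpP fun e => p e ∧ q e :=
  (eq_zero (Cmp.add hp.not.cmp hq.not.cmp)).congr fun e => by
    by_cases p e <;> by_cases q e <;> simp [*]

theorem or (hp : CmpP p) (hq : CmpP q) : CmpP fun e => p e ∨ q e :=
  (hp.not.and hq.not).not.congr fun e => by tauto

theorem imp (hp : CmpP p) (hq : CmpP q) : CmpP fun e => p e → q e :=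
  (hp.not.or hq).congr fun e => by tauto

theorem le (hf : Cmp f) (hg : Cmp g) : CmpP fun e => f e ≤ g e :=
  (eq_zero (hf.sub hg)).congr fun e => by omega

theorem lt (hf : Cmp f) (hg : Cmp g) : CmpP fun e => f e < g e :=
  (le hf.succ hg).congr fun _ => Iff.rfl

theorem eq (hf : Cmp f) (hg : Cmp g) : CmpP fun e => f e = g e :=
  ((le hf hg).and (le hg hf)).congr fun e => by omega

theorem const (P : Prop) : CmpP fun _ => P := by
  by_cases h : P
  · exact (eq Cmp.zero Cmp.zero).congr fun e => by simp [h]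
  · exact (eq Cmp.zero (Cmp.const 1)).congr fun e => by simp [h]

/-- Bounded existential quantification. -/
theorem ex {n : Ctx → ℕ} {Q : Ctx → ℕ → Prop} (hn : Cmp n) (hQ : CmpP fun e => Q e.pop (e.v 0)) :
    CmpP fun e => ∃ i < n e, Q e i := by
  classical
  exact (eq_zero (Cmp.sum (F := fun e i => if Q e i then 1 else 0) hn hQ.cmp)).not.congr
    fun e => by simp

/-- Bounded universal quantification. -/
theorem all {n : Ctx → ℕ} {Q : Ctx → ℕ → Prop} (hn : Cmp n) (hQ : CmpP fun e => Q e.pop (e.v 0)) :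
    CmpP fun e => ∀ i < n e, Q e i :=
  (ex (Q := fun e i => ¬ Q e i) hn hQ.not).not.congr fun e => by simp

end CmpP

namespace Cmp

variable {f g h k : Ctx → ℕ}

theorem div (hf : Cmp f) (hg : Cmp g) : Cmp fun e => f e / g e := by
  classical
  refine (sum (F := fun e i => if 0 < g e ∧ (i + 1) * g e ≤ f e then 1 else 0) hf
    ((CmpP.lt zero hg.pop).and (.le ((var 0).succ.mul hg.pop) hf.pop)).cmp).congr fun e => ?_
  rcases Nat.eq_zero_or_pos (g e) with h0 | h0
  · simp [h0]
  · have : ∀ i, (i + 1) * g e ≤ f e ↔ i < f e / g e := fun i => by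
      rw [← Nat.le_div_iff_mul_le h0, Nat.lt_iff_add_one_le]
    simp only [h0, true_and, this]
    have h1 : (Finset.range (f e)).filter (fun i => i < f e / g e) =
        Finset.range (f e / g e) := by
      ext i
      have := Nat.div_le_self (f e) (g e)
      simp only [Finset.mem_filter, Finset.mem_range]
      omega
    rw [Finset.sum_boole, h1]
    simp

theorem mod (hf : Cmp f) (hg : Cmp g) : Cmp fun e => f e % g e :=
  (hf.sub (hg.mul (hf.div hg))).congr fun _ => Nat.mod_eq_sub_mul_div.symm

end Cmp

/-- Powers of `b`, cut off at `P` so that all values stay polynomially bounded. -/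
def powCap (b P : ℕ) : ℕ → ℕ
  | 0 => 1
  | s + 1 => min (powCap b P s * b) P

theorem powCap_eq {b P s : ℕ} (hb : 0 < b) (h : b ^ s ≤ P) : powCap b P s = b ^ s := by
  induction s with
  | zero => rfl
  | succ s ih =>
    rw [powCap, ih ((Nat.pow_le_pow_right hb (Nat.le_succ s)).trans h), ← pow_succ,
      min_eq_left h]

theorem powCap_le (b P s : ℕ) : powCap b P s ≤ P + 1 := by
  cases s with
  | zero => exact Nat.le_add_left 1 P
  | succ s => exact (min_le_right _ _).trans (Nat.le_succ P)

theorem Cmp.powCap {f g h : Ctx → ℕ} (hf : Cmp f) (hg : Cmp g) (hh : Cmp h) :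
    Cmp fun e => powCap (f e) (g e) (h e) := by
  have hmin : Cmp fun e => min (e.v 0 * f e.pop.pop) (g e.pop.pop) :=
    (Cmp.ite (.le ((var 0).mul hf.pop.pop) hg.pop.pop) ((var 0).mul hf.pop.pop)
      hg.pop.pop).congr fun e => (min_def _ _).symm
  exact iter (F := fun e x _ => min (x * f e) (g e)) hh (const 1) hmin
    (fun e i x => ∃ j, j + i = h e ∧ x = _root_.powCap (f e) (g e) j)
    (fun e => ⟨0, Nat.zero_add _, rfl⟩)
    (fun e i x ⟨j, hj, hx⟩ => ⟨j + 1, by omega, by rw [hx]; rfl⟩)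
    (hg.choose_spec.2.1.add (.const 1))
    (fun e i x _ ⟨j, hj, hx⟩ => hx ▸ powCap_le _ _ _)
    (fun e x ⟨j, hj, hx⟩ => by rw [hx, ← hj]; rfl)

/-- Digit number `s` of `x` in base `b`, for numbers `x` below `P`. -/
def digit (b P x s : ℕ) : ℕ := x / powCap b P s % b

theorem Cmp.digit {b P x s : Ctx → ℕ} (hb : Cmp b) (hP : Cmp P) (hx : Cmp x) (hs : Cmp s) :
    Cmp fun e => digit (b e) (P e) (x e) (s e) :=
  (hx.div (hb.powCap hP hs)).mod hb

/-! ### Tabulation in exponential time -/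

theorem PolyBdd.pow {f : Ctx → ℕ} (hf : PolyBdd f) (n : ℕ) : PolyBdd fun e => f e ^ n :=
  let ⟨c, hc⟩ := hf
  ⟨c * n, fun e M he => by
    rw [pow_mul]
    exact Nat.pow_le_pow_left (hc e M he) n⟩

/-- The context with a given input word and table and one variable. -/
def tableCtx (x tab : List Bool) (P : ℕ) : Ctx :=
  Ctx.push ⟨x, tab, fun _ => 0⟩ P

open Classical in
/-- The table whose bits are computed one after the other from the preceding ones. -/
noncomputable def table (φ : Ctx → Prop) (x : List Bool) (P : ℕ) : ℕ → List Bool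
  | 0 => []
  | a + 1 => decide (φ (tableCtx x (table φ x P a) P)) :: table φ x P a

theorem length_table (φ : Ctx → Prop) (x : List Bool) (P a : ℕ) :
    (table φ x P a).length = a := by
  induction a with
  | zero => rfl
  | succ a ih => rw [table, List.length_cons, ih]

theorem tableCtx_v (x tab : List Bool) (P i : ℕ) (hi : 1 ≤ i) : (tableCtx x tab P).v i = 0 := by
  obtain ⟨i, rfl⟩ := Nat.exists_eq_add_of_le' hi
  rfl

theorem tableCtx_bdd {x tab : List Bool} {P M : ℕ} (hx : x.length ≤ M) (ht : tab.length ≤ M)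
    (hP : P ≤ M) : (tableCtx x tab P).Bdd M :=
  ⟨hx, ht, fun i => by
    cases i with
    | zero => exact hP
    | succ i => exact Nat.zero_le M⟩

section

open Function Prog

theorem Ctx.store_tab (d : ℕ) (e : Ctx) (l : List Bool) :
    (⟨e.inp, l, e.v⟩ : Ctx).store d = update (e.store d) 1 l := by
  funext k
  match k with
  | 0 => rw [update_of_ne (by omega)]; rfl
  | 1 => rw [update_self]; rfl
  | k + 2 => rw [update_of_ne (by omega)]; rfl

/-- Move a truth value, given as a number on stack `k`, to stack `1`. -/
def pushBit (k : ℕ) : Prog :=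
  cases k (push 1 false) skip (seq (clear k) (push 1 true))

theorem pushBit_runsIn {k : ℕ} (hk : k ≠ 1) (s : ℕ → List Bool) (P : Prop) [Decidable P]
    (h : s k = List.replicate (if P then 1 else 0) true) :
    (pushBit k).RunsIn s (update (update s k []) 1 (decide P :: s 1)) 5 := by
  by_cases hP : P
  · have h' : s k = [true] := by simpa [hP] using h
    have h1 := (clear_runsIn k s).seq (RunsIn.push 1 true _)
    refine (RunsIn.cases_true h' h1).of_eq ?_ ?_
    · rw [update_of_ne hk.symm]
      simp [hP]
    · rw [h']
      simp
  · have h' : s k = [] := by simpa [hP] using h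
    refine (RunsIn.cases_nil h' (RunsIn.push 1 false s)).of_eq ?_ (by omega)
    rw [← h', update_eq_self]
    simp [hP]

/-- The loop that extends the table until the counter, which is the last of two variables, has come
down to zero. -/
def tableLoop (t : Tm) : Prog :=
  loop 3 (seq (pop 3) (seq (t.comp 2) (pushBit 4)))

open Classical in
theorem tableLoop_runsIn (φ : Ctx → Prop) (t : Tm)
    (ht : ∀ e, t.eval e = if φ e.pop then 1 else 0) (x : List Bool) (P N C : ℕ)
    (hC : ∀ a i, a ≤ N → i ≤ N → t.cost ((tableCtx x (table φ x P a) P).push i) ≤ C) :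
    ∀ i a, a + i = N → (tableLoop t).RunsIn (((tableCtx x (table φ x P a) P).push i).store 2)
      ((tableCtx x (table φ x P N) P).store 1) (i * (C + 7) + 1) := by
  intro i
  induction i with
  | zero =>
    intro a ha
    obtain rfl : a = N := ha
    rw [Ctx.store_push_zero]
    exact (RunsIn.loop_nil (Ctx.store_of_le _ le_rfl)).mono (by omega)
  | succ i ih =>
    intro a ha
    set e := tableCtx x (table φ x P a) P with he
    have h1 := RunsIn.pop 3 ((e.push (i + 1)).store 2)
    have e1 : update ((e.push (i + 1)).store 2) 3 (((e.push (i + 1)).store 2) 3).tail =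
        (e.push i).store 2 := by
      rw [Ctx.store_push, Ctx.store_push, update_self, update_idem]
      rfl
    rw [e1] at h1
    have h2 := t.comp_runsIn 2 (e.push i) fun j hj => by
      obtain ⟨j, rfl⟩ := Nat.exists_eq_add_of_le' (show 1 ≤ j by omega)
      exact tableCtx_v _ _ _ j (by omega)
    rw [ht] at h2
    have h3 := pushBit_runsIn (k := 4) (by omega) (((e.push i).push
      (if φ (e.push i).pop then 1 else 0)).store 3) (φ (e.push i).pop)
      (by rw [Ctx.store_push, update_self])
    have e3 : update (update (((e.push i).push (if φ (e.push i).pop then 1 else 0)).store 3) 4 [])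
        1 (decide (φ (e.push i).pop) :: ((e.push i).push
        (if φ (e.push i).pop then 1 else 0)).store 3 1) =
        ((tableCtx x (table φ x P (a + 1)) P).push i).store 2 := by
      have : update (((e.push i).push (if φ (e.push i).pop then 1 else 0)).store 3) 4 [] =
          (e.push i).store 2 := by
        rw [Ctx.store_push, update_idem, update_eq_self_iff, Ctx.store_of_le _ le_rfl]
      rw [this, ← Ctx.store_tab]
      rfl
    rw [e3] at h3
    have hne : (e.push (i + 1)).store 2 3 ≠ [] := by
      rw [Ctx.store_push, update_self]
      simp
    refine (RunsIn.loop_cons hne (h1.seq (h2.seq h3)) (ih (a + 1) (by omega))).mono ?_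
    have := hC a i (by omega) (by omega)
    rw [← he] at this
    rw [add_mul i 1]
    omega

/-- The program that computes a number `P` and from it a table and a bit of output. -/
def tableProg (tP tN tφ tψ : Tm) : Prog :=
  seq (tP.comp 0) <| seq (tN.comp 1) <| seq (tableLoop tφ) <| seq (tψ.comp 1) <|
    seq (clear 1) <| seq (clear 2) <| seq (pushBit 3) (clear 0)

open Classical in
theorem tableProg_runsIn (φ ψ : Ctx → Prop) (tP tN tφ tψ : Tm) (x : List Bool) (P N C : ℕ)
    (hP : tP.eval ⟨x, [], fun _ => 0⟩ = P) (hN : tN.eval (tableCtx x [] P) = N)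
    (hφ : ∀ e, tφ.eval e = if φ e.pop then 1 else 0) (hψ : ∀ e, tψ.eval e = if ψ e then 1 else 0)
    (hC : ∀ a i, a ≤ N → i ≤ N → tφ.cost ((tableCtx x (table φ x P a) P).push i) ≤ C) :
    (tableProg tP tN tφ tψ).RunsIn (update (fun _ => []) 0 x)
      (update (fun _ => []) 1 [decide (ψ (tableCtx x (table φ x P N) P))])
      (tP.cost ⟨x, [], fun _ => 0⟩ + tN.cost (tableCtx x [] P) + (N * (C + 7) + 1) +
        tψ.cost (tableCtx x (table φ x P N) P) + 2 * N + 2 * P + 2 * x.length + 8) := by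
  have h1 := tP.comp_runsIn 0 ⟨x, [], fun _ => 0⟩ fun _ _ => rfl
  have e0 : (⟨x, [], fun _ => 0⟩ : Ctx).store 0 = update (fun _ => []) 0 x := by
    funext k
    match k with
    | 0 => rw [update_self]; rfl
    | 1 => rw [update_of_ne (by omega)]; rfl
    | k + 2 => rw [update_of_ne (by omega)]; exact Ctx.store_of_le _ (by omega)
  rw [hP, e0] at h1
  have h2 := tN.comp_runsIn 1 (tableCtx x [] P) (tableCtx_v x [] P)
  rw [hN] at h2
  have h3 := tableLoop_runsIn φ tφ hφ x P N C hC N 0 (Nat.zero_add N)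
  set e := tableCtx x (table φ x P N) P with he
  have h4 := tψ.comp_runsIn 1 e (tableCtx_v _ _ _)
  rw [hψ] at h4
  set b := if ψ e then 1 else 0 with hb
  have hs : (e.push b).store 2 = update (update (update (update (fun _ => []) 0 x) 1
      (table φ x P N)) 2 (List.replicate P true)) 3 (List.replicate b true) := by
    rw [Ctx.store_push, he, tableCtx, Ctx.store_push, ← e0, ← Ctx.store_tab]
  have h5 := clear_runsIn 1 ((e.push b).store 2)
  have h6 := clear_runsIn 2 (update ((e.push b).store 2) 1 [])
  have h7 := pushBit_runsIn (k := 3) (by omega) (update (update ((e.push b).store 2) 1 []) 2 [])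
    (ψ e) (by rw [hs]; simp [hb])
  have h8 := clear_runsIn 0 (update (update (update (update ((e.push b).store 2) 1 []) 2 []) 3 [])
    1 (decide (ψ e) :: (update (update ((e.push b).store 2) 1 []) 2 []) 1))
  refine (h1.seq (h2.seq (h3.seq (h4.seq (h5.seq (h6.seq (h7.seq h8))))))).of_eq ?_ ?_
  · rw [hs]
    funext k
    simp only [update_apply]
    split_ifs <;> simp_all
  · have l5 : ((e.push b).store 2 1).length = N := by rw [hs]; simp [length_table]
    have l6 : (update ((e.push b).store 2) 1 [] 2).length = P := by rw [hs]; simp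
    have l8 : ((update (update (update (update ((e.push b).store 2) 1 []) 2 []) 3 [])
        1 (decide (ψ e) :: (update (update ((e.push b).store 2) 1 []) 2 []) 1)) 0).length =
        x.length := by rw [hs]; simp
    rw [l5, l6, l8]
    omega

end

/-- There is a term for `n ^ n`, where `n` is the length of the input word, whose evaluation takes
time polynomial in its value. -/
theorem exists_powTm : ∃ (t : Tm) (c : ℕ), ∀ x : List Bool,
    t.eval ⟨x, [], fun _ => 0⟩ = x.length ^ x.length ∧
    t.cost ⟨x, [], fun _ => 0⟩ ≤ (x.length ^ x.length + x.length + 2) ^ c := by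
  obtain ⟨tm, htm, -, c, hc⟩ := (Cmp.var 0).mul Cmp.lenInp
  obtain ⟨d, hd⟩ : PolyBdd fun e => (e.v 0 * ((e.v 0 + 2) ^ c + 6 * e.v 0 + 4) + 4 * e.v 0 + 2) +
      (9 * e.v 0 + 2 + 2) :=
    ((((PolyBdd.var 0).mul (((((PolyBdd.var 0).add (.const 2)).pow c).add
      ((PolyBdd.const 6).mul (.var 0))).add (.const 4))).add ((PolyBdd.const 4).mul (.var 0))).add
      (.const 2)).add ((((PolyBdd.const 9).mul (.var 0)).add (.const 2)).add (.const 2))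
  refine ⟨.iter (.len false) (.succ .zero) tm, d, fun x => ?_⟩
  set n := x.length with hn
  have hI : ∀ i acc, i + 1 ≤ n ∧ acc = n ^ (n - (i + 1)) → i ≤ n ∧
      tm.eval ((Ctx.push ⟨x, [], fun _ => 0⟩ i).push acc) = n ^ (n - i) := by
    rintro i acc ⟨hi, rfl⟩
    refine ⟨by omega, ?_⟩
    rw [htm, show n - i = n - (i + 1) + 1 by omega, pow_succ]
    rfl
  constructor
  · have h := (downFold_inv (I := fun i acc => i ≤ n ∧ acc = n ^ (n - i)) hI n 1
      ⟨le_rfl, by simp⟩).2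
    simpa [Tm.eval, Tm.word, ← hn] using h
  · set M := n ^ n + n with hM
    have hG : ∀ i acc, i ≤ n → (i ≤ n ∧ acc = n ^ (n - i)) → acc ≤ M := by
      rintro i acc - ⟨hi, rfl⟩
      rcases Nat.eq_zero_or_pos n with h0 | h0
      · simp [hM, h0]
      · exact (Nat.pow_le_pow_right h0 (Nat.sub_le n i)).trans (Nat.le_add_right _ _)
    have h := downCost_le (G := M) (C := (M + 2) ^ c)
      (c := fun acc i => tm.cost ((Ctx.push ⟨x, [], fun _ => 0⟩ i).push acc))
      (I := fun i acc => i ≤ n ∧ acc = n ^ (n - i)) n 1 (fun i acc _ => hI i acc) hG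
      (fun i acc hi hacc => hc _ M ⟨Nat.le_add_left _ _, Nat.zero_le _, fun j => by
        match j with
        | 0 => exact hacc
        | 1 => exact hi.le.trans (Nat.le_add_left _ _)
        | j + 2 => exact Nat.zero_le _⟩) ⟨le_rfl, by simp⟩
    have h2 := hd (tableCtx [] [] M) M (tableCtx_bdd (Nat.zero_le _) (Nat.zero_le _) le_rfl)
    refine le_trans ?_ h2
    change _ ≤ (M * ((M + 2) ^ c + 6 * M + 4) + 4 * M + 2) + (9 * M + 2 + 2)
    have h3 : n * ((M + 2) ^ c + 6 * M + 4) ≤ M * ((M + 2) ^ c + 6 * M + 4) :=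
      Nat.mul_le_mul_right _ (Nat.le_add_left _ _)
    have h4 : n ≤ M := Nat.le_add_left _ _
    simp only [Tm.cost, Tm.eval, Tm.word, ← hn, Nat.zero_add]
    clear_value M n
    omega

/-- A language is in EXP if membership of a word `x` can be read off, in polynomial time, from a
table of bits each of which can be computed in polynomial time from `x`, the preceding bits and the
number `n ^ n` in unary, where `n` is the length of `x`. -/
theorem inEXP_of_table {N : Ctx → ℕ} {φ ψ : Ctx → Prop} (hN : Cmp N) (hφ : CmpP φ) (hψ : CmpP ψ)
    (L : Language Bool)
    (hL : ∀ x : List Bool, x ∈ L ↔ ψ (tableCtx x (table φ x (x.length ^ x.length)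
      (N (tableCtx x [] (x.length ^ x.length)))) (x.length ^ x.length))) : InEXP L := by
  classical
  obtain ⟨tP, cP, htP⟩ := exists_powTm
  obtain ⟨tN, hN, ⟨a, ha⟩, cN, hcN⟩ := hN
  obtain ⟨tφ, hφ, -, cφ, hcφ⟩ := hφ.pop
  obtain ⟨tψ, hψ, -, cψ, hcψ⟩ := hψ
  obtain ⟨d, hd⟩ : PolyBdd fun e => ((e.v 0 + 2) ^ cP + (e.v 0 + 2) ^ cN +
      (e.v 0 * ((e.v 0 + 2) ^ cφ + 7) + 1) + (e.v 0 + 2) ^ cψ + 2 * e.v 0 + 2 * e.v 0 +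
      2 * e.v 0 + 8) + 1 := by
    have h1 := (PolyBdd.var 0).add (.const 2)
    have h2 := (PolyBdd.const 2).mul (.var 0)
    exact ((((((((h1.pow cP).add (h1.pow cN)).add (((PolyBdd.var 0).mul
      ((h1.pow cφ).add (.const 7))).add (.const 1))).add (h1.pow cψ)).add h2).add h2).add h2).add
      (.const 8)).add (.const 1)
  refine Prog.inEXP_of_runs (tableProg tP tN tφ tψ) L
    (Polynomial.C ((a + 2) * d) * (Polynomial.X ^ 2 + Polynomial.X + Polynomial.C 2)) fun x => ?_
  set n := x.length with hn
  set P := n ^ n with hP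
  set B := N (tableCtx x [] P) with hB
  set M := (P + n + 2) ^ (a + 1) with hM
  have hPM : P + n + 2 ≤ M := Nat.le_self_pow (by omega) _
  have hBM : B ≤ M := (ha _ (P + n) (tableCtx_bdd (by omega) (Nat.zero_le _) (by omega))).trans
    (Nat.pow_le_pow_right (by omega) (by omega))
  have hC : ∀ k i, k ≤ B → i ≤ B → tφ.cost ((tableCtx x (table φ x P k) P).push i) ≤
      (M + 2) ^ cφ := fun k i hk hi =>
    hcφ _ M ((tableCtx_bdd (by omega) (by rw [length_table]; omega) (by omega)).push (by omega))
  obtain ⟨t, ht, hr⟩ := tableProg_runsIn φ ψ tP tN tφ tψ x P B _ (htP x).1 (hN _) hφ hψ hC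
  refine ⟨_, by rw [decide_eq_true_iff]; exact (hL x).symm, t, ?_, hr⟩
  have h1 := hd (tableCtx [] [] M) M (tableCtx_bdd (Nat.zero_le _) (Nat.zero_le _) le_rfl)
  have h2 : tN.cost (tableCtx x [] P) ≤ (M + 2) ^ cN :=
    hcN _ M (tableCtx_bdd (by omega) (Nat.zero_le _) (by omega))
  have h3 : tψ.cost (tableCtx x (table φ x P B) P) ≤ (M + 2) ^ cψ :=
    hcψ _ M (tableCtx_bdd (by omega) (by rw [length_table]; omega) (by omega))
  have h4 : tP.cost ⟨x, [], fun _ => 0⟩ ≤ (M + 2) ^ cP := by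
    refine (htP x).2.trans (Nat.pow_le_pow_left ?_ _)
    rw [← hn, ← hP]
    exact hPM.trans (Nat.le_add_right _ _)
  have hxn : x.length = n := hn.symm
  have hPn : P = n ^ n := hP
  have hMn : M = (P + n + 2) ^ (a + 1) := hM
  clear_value M B P n
  have h5 : B * ((M + 2) ^ cφ + 7) ≤ M * ((M + 2) ^ cφ + 7) := Nat.mul_le_mul_right _ hBM
  have h6 : t + 1 ≤ (M + 2) ^ d := by
    refine le_trans ?_ h1
    change _ ≤ ((M + 2) ^ cP + (M + 2) ^ cN + (M * ((M + 2) ^ cφ + 7) + 1) + (M + 2) ^ cψ +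
      2 * M + 2 * M + 2 * M + 8) + 1
    omega
  refine h6.trans ?_
  have h7 : P + n + 2 ≤ 2 ^ (n ^ 2 + n + 2) := by
    have h8 : P ≤ 2 ^ (n ^ 2) := by
      rw [hPn, sq, pow_mul]
      exact Nat.pow_le_pow_left Nat.lt_two_pow_self.le n
    have h9 : n + 2 ≤ 2 ^ (n + 1) := Nat.lt_two_pow_self
    have h10 : 2 ^ (n ^ 2) ≤ 2 ^ (n ^ 2 + n + 1) := Nat.pow_le_pow_right (by omega) (by omega)
    have h11 : 2 ^ (n + 1) ≤ 2 ^ (n ^ 2 + n + 1) := Nat.pow_le_pow_right (by omega) (by omega)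
    rw [pow_succ 2 (n ^ 2 + n + 1)]
    omega
  have h12 : M + 2 ≤ (P + n + 2) ^ (a + 2) := by
    rw [pow_succ (P + n + 2) (a + 1), ← hMn]
    nlinarith
  calc (M + 2) ^ d ≤ ((2 ^ (n ^ 2 + n + 2)) ^ (a + 2)) ^ d :=
        Nat.pow_le_pow_left (h12.trans (Nat.pow_le_pow_left h7 _)) d
    _ = 2 ^ ((a + 2) * d * (n ^ 2 + n + 2)) := by
        rw [← pow_mul, ← pow_mul]
        ring_nf
    _ = _ := by simp

/-! ### Counting turns -/

namespace DVPDA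

variable {Q C I R G : Type}

/-- The turn counter after a push. An even counter means that the last change of the stack height
(if any) was an increase, an odd one that it was a decrease. Turns are counted for `κ = 1`; for
`κ = 0` the counter never changes. -/
def turnUp (κ m : ℕ) : ℕ := m + κ * (m % 2)

/-- The turn counter after a pop. -/
def turnDown (κ m : ℕ) : ℕ := m + κ * ((m + 1) % 2)

/-- The turn counter after reading a letter with stack content `v`. -/
def turnStep (κ : ℕ) (v : List G) : Letter C I R → ℕ → ℕ
  | .call _, m => turnUp κ m
  | .int _, m => m
  | .ret _, m => if v = [] then m else turnDown κ m

/-- The turn counter after reading a word from the configuration `c`, when it is `m` before. -/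
def turns (M : DVPDA Q C I R G) (κ : ℕ) : Q × List G → ℕ → List (Letter C I R) → ℕ
  | _, m, [] => m
  | c, m, a :: w => M.turns κ (M.step c a) (turnStep κ c.2 a m) w

theorem le_turnUp (κ m : ℕ) : m ≤ turnUp κ m := Nat.le_add_right _ _

theorem le_turnDown (κ m : ℕ) : m ≤ turnDown κ m := Nat.le_add_right _ _

theorem le_turnStep (κ : ℕ) (v : List G) (a : Letter C I R) (m : ℕ) : m ≤ turnStep κ v a m := by
  cases a with
  | call a => exact le_turnUp κ m
  | int a => exact le_rfl
  | ret a =>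
    simp only [turnStep]
    split_ifs
    · exact le_rfl
    · exact le_turnDown κ m

variable (M : DVPDA Q C I R G)

theorem run_append (c : Q × List G) (w w' : List (Letter C I R)) :
    M.run c (w ++ w') = M.run (M.run c w) w' := List.foldl_append

theorem turns_append (κ : ℕ) (c : Q × List G) (m : ℕ) (w w' : List (Letter C I R)) :
    M.turns κ c m (w ++ w') = M.turns κ (M.run c w) (M.turns κ c m w) w' := by
  induction w generalizing c m with
  | nil => rfl
  | cons a w ih => exact ih _ _

theorem le_turns (κ : ℕ) (c : Q × List G) (m : ℕ) (w : List (Letter C I R)) :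
    m ≤ M.turns κ c m w := by
  induction w generalizing c m with
  | nil => exact le_rfl
  | cons a w ih => exact (le_turnStep κ c.2 a m).trans (ih _ _)

theorem turns_zero (c : Q × List G) (m : ℕ) (w : List (Letter C I R)) :
    M.turns 0 c m w = m := by
  induction w generalizing c m with
  | nil => rfl
  | cons a w ih =>
    rw [turns, ih]
    cases a <;> simp [turnStep, turnUp, turnDown]

theorem isUpstroke_cons (c : Q × List G) (a : Letter C I R) (w : List (Letter C I R)) :
    M.IsUpstroke c (a :: w) ↔ c.2.length ≤ (M.step c a).2.length ∧ M.IsUpstroke (M.step c a) w := by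
  constructor
  · intro h
    exact ⟨h [] a (by simp), fun u b hu => h (a :: u) b (by simpa using hu)⟩
  · rintro ⟨h1, h2⟩ u b hu
    cases u with
    | nil =>
      obtain rfl : b = a := by simpa using hu
      exact h1
    | cons a' u =>
      obtain ⟨rfl, hu'⟩ : a' = a ∧ u ++ [b] <+: w := by simpa using hu
      exact h2 u b hu'

theorem isDownstroke_cons (c : Q × List G) (a : Letter C I R) (w : List (Letter C I R)) :
    M.IsDownstroke c (a :: w) ↔
      (M.step c a).2.length ≤ c.2.length ∧ M.IsDownstroke (M.step c a) w := by
  constructor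
  · intro h
    exact ⟨h [] a (by simp), fun u b hu => h (a :: u) b (by simpa using hu)⟩
  · rintro ⟨h1, h2⟩ u b hu
    cases u with
    | nil =>
      obtain rfl : b = a := by simpa using hu
      exact h1
    | cons a' u =>
      obtain ⟨rfl, hu'⟩ : a' = a ∧ u ++ [b] <+: w := by simpa using hu
      exact h2 u b hu'

theorem turnStep_up {c : Q × List G} {a : Letter C I R} (m : ℕ)
    (h : c.2.length ≤ (M.step c a).2.length) :
    turnStep 1 c.2 a m = m ∨ turnStep 1 c.2 a m = turnUp 1 m := by
  obtain ⟨q, v⟩ := c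
  cases a with
  | call a => exact Or.inr rfl
  | int a => exact Or.inl rfl
  | ret a =>
    cases v with
    | nil => exact Or.inl rfl
    | cons g v => simp [step] at h

theorem turnStep_down {c : Q × List G} {a : Letter C I R} (m : ℕ)
    (h : (M.step c a).2.length ≤ c.2.length) :
    turnStep 1 c.2 a m = m ∨ turnStep 1 c.2 a m = turnDown 1 m := by
  obtain ⟨q, v⟩ := c
  cases a with
  | call a => simp [step] at h
  | int a => exact Or.inl rfl
  | ret a =>
    cases v with
    | nil => exact Or.inl rfl
    | cons g v => exact Or.inr rfl

theorem turns_le_of_isUpstroke {c : Q × List G} {w : List (Letter C I R)}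
    (h : M.IsUpstroke c w) (m : ℕ) : M.turns 1 c m w ≤ turnUp 1 m := by
  induction w generalizing c m with
  | nil => exact le_turnUp 1 m
  | cons a w ih =>
    obtain ⟨h1, h2⟩ := (M.isUpstroke_cons c a w).1 h
    refine (ih h2 _).trans ?_
    rcases M.turnStep_up m h1 with h3 | h3
    · rw [h3]
    · rw [h3]
      simp only [turnUp]
      omega

theorem turns_le_of_isDownstroke {c : Q × List G} {w : List (Letter C I R)}
    (h : M.IsDownstroke c w) (m : ℕ) : M.turns 1 c m w ≤ turnDown 1 m := by
  induction w generalizing c m with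
  | nil => exact le_turnDown 1 m
  | cons a w ih =>
    obtain ⟨h1, h2⟩ := (M.isDownstroke_cons c a w).1 h
    refine (ih h2 _).trans ?_
    rcases M.turnStep_down m h1 with h3 | h3
    · rw [h3]
    · rw [h3]
      simp only [turnDown]
      omega

theorem turns_le_of_atMostStrokes {n : ℕ} {c : Q × List G} {w : List (Letter C I R)}
    (h : M.AtMostStrokes n c w) (m : ℕ) : M.turns 1 c m w ≤ m + n := by
  induction n generalizing c w m with
  | zero =>
    obtain rfl : w = [] := h
    exact le_rfl
  | succ n ih =>
    obtain ⟨u, v, rfl, hu, hv⟩ := h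
    rw [turns_append]
    refine (ih hv _).trans ?_
    rcases hu with hu | hu
    · have := M.turns_le_of_isUpstroke hu m
      simp only [turnUp] at this
      omega
    · have := M.turns_le_of_isDownstroke hu m
      simp only [turnDown] at this
      omega

/-- A word with few turns splits into few strokes, the direction of the first of which is given by
the parity of the turn counter at the beginning. -/
theorem exists_stroke_of_turns_le {c : Q × List G} {w : List (Letter C I R)} {m n : ℕ}
    (h : M.turns 1 c m w ≤ m + n) :
    ∃ u v, w = u ++ v ∧ (if m % 2 = 0 then M.IsUpstroke c u else M.IsDownstroke c u) ∧
      M.AtMostStrokes n (M.run c u) v := by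
  induction w generalizing c m n with
  | nil =>
    refine ⟨[], [], rfl, ?_, ?_⟩
    · split_ifs
      · intro u a hu; simp at hu
      · intro u a hu; simp at hu
    · induction n with
      | zero => rfl
      | succ n ih =>
        exact ⟨[], [], rfl, Or.inl fun u a hu => by simp at hu, ih (Nat.le_add_right m n)⟩
  | cons a w ih =>
    have hcase : (turnStep 1 c.2 a m = m ∧
        (if m % 2 = 0 then c.2.length ≤ (M.step c a).2.length
          else (M.step c a).2.length ≤ c.2.length)) ∨
        (turnStep 1 c.2 a m = m + 1 ∧ (if (m + 1) % 2 = 0 then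
          c.2.length ≤ (M.step c a).2.length else (M.step c a).2.length ≤ c.2.length)) := by
      obtain ⟨q, v⟩ := c
      rcases Nat.mod_two_eq_zero_or_one m with hm | hm
      · have hm' : (m + 1) % 2 = 1 := by omega
        cases a with
        | call a => simp [turnStep, turnUp, hm, step]
        | int a => simp [turnStep, hm, step]
        | ret a => cases v <;> simp [turnStep, turnDown, hm, hm', step]
      · have hm' : (m + 1) % 2 = 0 := by omega
        cases a with
        | call a => simp [turnStep, turnUp, hm, hm', step]
        | int a => simp [turnStep, hm, step]
        | ret a => cases v <;> simp [turnStep, turnDown, hm, hm', step]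
    rw [turns] at h
    have hcons : ∀ {k : ℕ} {u : List (Letter C I R)},
        (if k % 2 = 0 then c.2.length ≤ (M.step c a).2.length
          else (M.step c a).2.length ≤ c.2.length) →
        (if k % 2 = 0 then M.IsUpstroke (M.step c a) u else M.IsDownstroke (M.step c a) u) →
        (if k % 2 = 0 then M.IsUpstroke c (a :: u) else M.IsDownstroke c (a :: u)) := by
      intro k u h1 h2
      split_ifs at h1 h2 ⊢
      · exact (M.isUpstroke_cons c a u).2 ⟨h1, h2⟩
      · exact (M.isDownstroke_cons c a u).2 ⟨h1, h2⟩
    rcases hcase with ⟨h1, h2⟩ | ⟨h1, h2⟩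
    · rw [h1] at h
      obtain ⟨u, v, rfl, hu, hv⟩ := ih h
      exact ⟨a :: u, v, rfl, hcons h2 hu, hv⟩
    · rw [h1] at h
      have hn : 1 ≤ n := by
        have := M.le_turns 1 (M.step c a) (m + 1) w
        omega
      obtain ⟨n, rfl⟩ := Nat.exists_eq_add_of_le' hn
      obtain ⟨u, v, rfl, hu, hv⟩ := ih (c := M.step c a) (m := m + 1) (n := n) (by omega)
      refine ⟨[], a :: (u ++ v), rfl, ?_, a :: u, v, rfl, ?_, hv⟩
      · split_ifs
        · intro u a hu; simp at hu
        · intro u a hu; simp at hu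
      · have := hcons h2 hu
        split_ifs at this
        · exact Or.inl this
        · exact Or.inr this

/-- Splitting into at most `n + 1` strokes means having at most `n` turns. The first stroke is not
counted, since the height can only increase at first. -/
theorem atMostStrokes_iff (q : Q) (n : ℕ) (w : List (Letter C I R)) :
    M.AtMostStrokes (n + 1) (q, []) w ↔ M.turns 1 (q, []) 0 w ≤ n := by
  constructor
  · rintro ⟨u, v, rfl, hu, hv⟩
    have h0 : M.turns 1 (q, []) 0 u = 0 := by
      rcases hu with hu | hu
      · exact Nat.le_zero.1 (M.turns_le_of_isUpstroke hu 0)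
      · have : ∀ (w : List (Letter C I R)) (q : Q), M.IsDownstroke (q, []) w →
            M.turns 1 (q, []) 0 w = 0 := by
          intro w
          induction w with
          | nil => intro q _; rfl
          | cons a w ih =>
            intro q h
            obtain ⟨h1, h2⟩ := (M.isDownstroke_cons _ a w).1 h
            cases a with
            | call a => simp [step] at h1
            | int a => exact ih _ h2
            | ret a => exact ih _ h2
        exact this u q hu
    rw [turns_append, h0]
    have := M.turns_le_of_atMostStrokes hv 0
    omega
  · intro h
    obtain ⟨u, v, rfl, hu, hv⟩ := M.exists_stroke_of_turns_le (c := (q, [])) (w := w)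
      (m := 0) (n := n) (by omega)
    exact ⟨u, v, rfl, Or.inl (by simpa using hu), hv⟩

/-! ### State transformations induced by words -/

/-- The state transformations induced by words, together with the turn counter before and after the
word. The first index is `0` for words that are well-nested and so can be read on any stack, `1` for
words that lead from the empty stack to the empty stack, and `2` for words that lead from the empty
stack to the stacks allowed by the stack model `S`. -/
inductive Der (κ : ℕ) (S : StackModel) : ℕ → ℕ → ℕ → (Q → Q) → Prop
  | id (d m) : Der κ S d m m fun q => q
  | int {d m m' τ} (a : I) : Der κ S d m m' τ → Der κ S d m m' fun q => M.intTrans (τ q) a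
  | nest {d m m₁ m₂ τ σ} (a : C) (b : R) : Der κ S d m m₁ τ → Der κ S 0 (turnUp κ m₁) m₂ σ →
      Der κ S d m (turnDown κ m₂) fun q =>
        M.retTrans (σ (M.callTrans (τ q) a).1) b (some (M.callTrans (τ q) a).2)
  | ret {m m' τ} (b : R) : Der κ S 1 m m' τ → Der κ S 1 m m' fun q => M.retTrans (τ q) b none
  | pending {m m' τ} : Der κ S 1 m m' τ → Der κ S 2 m m' τ
  | call {m m' τ} (a : C) (hS : S ≠ .empty)
      (hs : S = .same → ∀ q q', (M.callTrans (τ q) a).2 = (M.callTrans (τ q') a).2) :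
      Der κ S 2 m m' τ → Der κ S 2 m (turnUp κ m') fun q => (M.callTrans (τ q) a).1

variable {M} {κ : ℕ} {S : StackModel}

theorem Der.le {d m m' : ℕ} {τ : Q → Q} (h : M.Der κ S d m m' τ) : m ≤ m' := by
  induction h with
  | id d m => exact le_rfl
  | int a _ ih => exact ih
  | @nest d m m₁ m₂ τ σ a b _ _ ih₁ ih₂ =>
    exact ih₁.trans ((le_turnUp κ m₁).trans (ih₂.trans (le_turnDown κ m₂)))
  | ret b _ ih => exact ih
  | pending _ ih => exact ih
  | @call m m' τ a hS hs _ ih => exact ih.trans (le_turnUp κ m')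

theorem Der.exists_word {d m m' : ℕ} {τ : Q → Q} (h : M.Der κ S d m m' τ) :
    ∃ w, ∀ q v, (d ≠ 0 → v = []) → (M.run (q, v) w).1 = τ q ∧ M.turns κ (q, v) m w = m' ∧
      (d ≠ 2 ∨ S = .empty → (M.run (q, v) w).2 = v) ∧
      (S = .same → ∀ q', (M.run (q, v) w).2 = (M.run (q', v) w).2) := by
  have hrun : ∀ {w : List (Letter C I R)} {c : Q × List G} {p : Q}, (M.run c w).1 = p →
      M.run c w = (p, (M.run c w).2) := fun h => Prod.ext h rfl
  induction h with
  | id d m => exact ⟨[], fun q v _ => ⟨rfl, rfl, fun _ => rfl, fun _ _ => rfl⟩⟩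
  | int a _ ih =>
    obtain ⟨w, hw⟩ := ih
    refine ⟨w ++ [.int a], fun q v hv => ?_⟩
    have hstep : ∀ q', (M.run (q', v) (w ++ [.int a])) =
        (M.intTrans (M.run (q', v) w).1 a, (M.run (q', v) w).2) := fun q' => by
      rw [run_append]; rfl
    obtain ⟨h1, h2, h3, h4⟩ := hw q v hv
    simp only [hstep, h1, turns_append, h2]
    exact ⟨trivial, rfl, h3, h4⟩
  | @nest d m m₁ m₂ τ σ a b _ _ ih₁ ih₂ =>
    obtain ⟨w₁, hw₁⟩ := ih₁
    obtain ⟨w₂, hw₂⟩ := ih₂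
    refine ⟨w₁ ++ ([.call a] ++ (w₂ ++ [.ret b])), fun q v hv => ?_⟩
    have hstep : ∀ q', M.run (q', v) (w₁ ++ ([.call a] ++ (w₂ ++ [.ret b]))) =
        (M.retTrans (σ (M.callTrans (τ q') a).1) b (some (M.callTrans (τ q') a).2),
          (M.run (q', v) w₁).2) := by
      intro q'
      obtain ⟨h1, h2, h3, h4⟩ := hw₁ q' v hv
      obtain ⟨k1, k2, k3, k4⟩ := hw₂ (M.callTrans (τ q') a).1
        ((M.callTrans (τ q') a).2 :: (M.run (q', v) w₁).2) (fun h => absurd rfl h)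
      rw [run_append, run_append, run_append, hrun h1]
      change M.step (M.run ((M.callTrans (τ q') a).1, _) w₂) (.ret b) = _
      rw [hrun k1, k3 (Or.inl (by omega))]
      rfl
    obtain ⟨h1, h2, h3, h4⟩ := hw₁ q v hv
    obtain ⟨k1, k2, k3, k4⟩ := hw₂ (M.callTrans (τ q) a).1
      ((M.callTrans (τ q) a).2 :: (M.run (q, v) w₁).2) (fun h => absurd rfl h)
    simp only [hstep]
    refine ⟨trivial, ?_, h3, h4⟩
    rw [turns_append, h2, turns_append, turns_append, hrun h1]
    change turnStep (C := C) (I := I) κ (M.run ((M.callTrans (τ q) a).1, _) w₂).2 (.ret b)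
      (M.turns κ ((M.callTrans (τ q) a).1, _) (turnUp κ m₁) w₂) = _
    rw [k2, k3 (Or.inl (by omega))]
    rfl
  | ret b _ ih =>
    obtain ⟨w, hw⟩ := ih
    refine ⟨w ++ [.ret b], fun q v hv => ?_⟩
    obtain rfl := hv (by omega)
    have hstep : ∀ q', (M.run (q', []) (w ++ [.ret b])) =
        (M.retTrans (M.run (q', []) w).1 b none, []) := fun q' => by
      obtain ⟨h1, h2, h3, h4⟩ := hw q' [] hv
      rw [run_append, hrun h1, h3 (Or.inl (by omega))]
      rfl
    obtain ⟨h1, h2, h3, h4⟩ := hw q [] hv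
    simp only [hstep, h1, turns_append, h2]
    refine ⟨trivial, ?_, fun _ => trivial, fun _ _ => trivial⟩
    rw [hrun h1, h3 (Or.inl (by omega))]
    rfl
  | pending _ ih =>
    obtain ⟨w, hw⟩ := ih
    refine ⟨w, fun q v hv => ?_⟩
    obtain ⟨h1, h2, h3, h4⟩ := hw q v fun _ => hv (by omega)
    exact ⟨h1, h2, fun _ => h3 (Or.inl (by omega)), h4⟩
  | call a hS hs _ ih =>
    obtain ⟨w, hw⟩ := ih
    refine ⟨w ++ [.call a], fun q v hv => ?_⟩
    have hstep : ∀ q', (M.run (q', v) (w ++ [.call a])) =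
        ((M.callTrans (M.run (q', v) w).1 a).1,
          (M.callTrans (M.run (q', v) w).1 a).2 :: (M.run (q', v) w).2) := fun q' => by
      rw [run_append]; rfl
    obtain ⟨h1, h2, h3, h4⟩ := hw q v hv
    simp only [hstep, h1, turns_append, h2]
    refine ⟨trivial, rfl, fun h => absurd h (by simp [hS]), fun h q' => ?_⟩
    rw [(hw q' v hv).1, hs h q q', h4 h q']

/-- The joint configurations, with turn counter, that are obtained by a transformation from empty
stack to empty stack followed by pending calls and transformations of well-nested words. -/
inductive Pend (M : DVPDA Q C I R G) (κ : ℕ) (S : StackModel) : (Q → Q × List G) → ℕ → Prop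
  | base {m τ} : M.Der κ S 1 0 m τ → Pend M κ S (fun q => (τ q, [])) m
  | push {F m₁ m σ} (a : C) : Pend M κ S F m₁ → M.Der κ S 0 (turnUp κ m₁) m σ →
      Pend M κ S (fun q => (σ (M.callTrans (F q).1 a).1, (M.callTrans (F q).1 a).2 :: (F q).2)) m

theorem Pend.step {F : Q → Q × List G} {m : ℕ} (h : Pend M κ S F m) (a : Letter C I R) (q₀ : Q) :
    Pend M κ S (fun q => M.step (F q) a) (turnStep κ (F q₀).2 a m) := by
  cases a with
  | call a => exact .push a h (.id 0 _)
  | int a =>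
    cases h with
    | base h => exact .base (h.int a)
    | push b h h' => exact .push b h (h'.int a)
  | ret b =>
    cases h with
    | base h => exact .base (h.ret b)
    | push a h h' =>
      -- the return letter closes the last pending call
      cases h with
      | base h => exact .base (h.nest a b h')
      | push c h h'' => exact .push c h (h''.nest a b h')

theorem pend_run (q₀ : Q) (w : List (Letter C I R)) :
    Pend M κ S (fun q => M.run (q, []) w) (M.turns κ (q₀, []) 0 w) := by
  induction w using List.reverseRecOn with
  | nil => exact .base (.id 1 0)
  | append_singleton w a ih =>
    have h := ih.step a q₀
    simp only [run_append, turns_append]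
    exact h

/-- A transformation of a well-nested word can follow any transformation. -/
theorem Der.trans {d m m' m'' : ℕ} {τ σ : Q → Q} (h : M.Der κ S d m m' τ)
    (h' : M.Der κ S 0 m' m'' σ) : M.Der κ S d m m'' fun q => σ (τ q) := by
  generalize hd : 0 = d' at h'
  induction h' with
  | id d m => exact h
  | int a _ ih => exact (ih h hd).int a
  | nest a b _ h₂ ih₁ _ => exact (ih₁ h hd).nest a b h₂
  | ret b _ _ => omega
  | pending _ _ => omega
  | call a hS hs _ _ => omega

theorem Pend.der [Nonempty Q] {F : Q → Q × List G} {m : ℕ} (h : Pend M κ S F m)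
    (he : S = .empty → ∀ q, (F q).2 = []) (hs : S = .same → ∀ q q', (F q).2 = (F q').2) :
    M.Der κ S 2 0 m fun q => (F q).1 := by
  induction h with
  | base h => exact .pending h
  | push a _ h' ih =>
    have hS : S ≠ .empty := fun hS => by simpa using he hS (Classical.arbitrary Q)
    refine ((ih (fun h => absurd h hS) fun h q q' => ?_).call a hS fun h q q' => ?_).trans h'
    · exact (List.cons.inj (hs h q q')).2
    · exact (List.cons.inj (hs h q q')).1

/-- Synchronization in terms of the induced transformations. -/
theorem exists_synchronizes_iff [Nonempty Q] (M : DVPDA Q C I R G) (κ n : ℕ) (S : StackModel) :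
    (∃ w, M.Synchronizes S w ∧ ∀ q, M.turns κ (q, []) 0 w ≤ n) ↔
      ∃ m ≤ n, ∃ τ, M.Der κ S 2 0 m τ ∧ ∃ s, ∀ q, τ q = s := by
  have q₀ := Classical.arbitrary Q
  constructor
  · rintro ⟨w, ⟨⟨s, hs⟩, hw⟩, hn⟩
    refine ⟨_, hn q₀, _, (pend_run q₀ w).der ?_ ?_, s, hs⟩
    · rintro rfl
      exact hw
    · rintro rfl
      exact hw
  · rintro ⟨m, hm, τ, h, s, hs⟩
    obtain ⟨w, hw⟩ := h.exists_word
    refine ⟨w, ⟨⟨s, fun q => ((hw q [] fun _ => rfl).1).trans (hs q)⟩, ?_⟩, fun q => ?_⟩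
    · cases S with
      | empty => exact fun q => (hw q [] fun _ => rfl).2.2.1 (Or.inr rfl)
      | same => exact fun q q' => (hw q [] fun _ => rfl).2.2.2 rfl q'
      | arb => trivial
    · rw [(hw q [] fun _ => rfl).2.1]
      exact hm

theorem exists_turnSynchronizes_iff [Nonempty Q] (M : DVPDA Q C I R G) (n : ℕ) (S : StackModel) :
    (∃ w, M.TurnSynchronizes n S w) ↔
      ∃ m ≤ n, ∃ τ, M.Der 1 S 2 0 m τ ∧ ∃ s, ∀ q, τ q = s := by
  rw [← exists_synchronizes_iff]
  simp only [TurnSynchronizes, atMostStrokes_iff]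

theorem exists_synchronizes_iff' [Nonempty Q] (M : DVPDA Q C I R G) (S : StackModel) :
    (∃ w, M.Synchronizes S w) ↔
      ∃ m ≤ 0, ∃ τ, M.Der 0 S 2 0 m τ ∧ ∃ s, ∀ q, τ q = s := by
  rw [← exists_synchronizes_iff]
  simp only [turns_zero, le_refl, implies_true, and_true]

end DVPDA

/-! ### Reading the description of an automaton -/

/-- The list of numbers `n₁, n₂, …` written as `1^{n₁}01^{n₂}0…`. -/
def unary (L : List ℕ) : List Bool := L.flatMap fun n => List.replicate n true ++ [false]

/-- The number of zeros among the first `j` symbols. -/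
def zeros (x : List Bool) (j : ℕ) : ℕ :=
  ∑ i ∈ Finset.range j, if Tm.symbol x[i]? = 1 then 1 else 0

/-- The number of ones between the zeros with numbers `k` and `k + 1`. -/
def entry (x : List Bool) (k : ℕ) : ℕ :=
  ∑ i ∈ Finset.range x.length, if Tm.symbol x[i]? = 2 ∧ zeros x i = k then 1 else 0

theorem zeros_cons (b : Bool) (x : List Bool) (j : ℕ) :
    zeros (b :: x) (j + 1) = zeros x j + if b = false then 1 else 0 := by
  rw [zeros, Finset.sum_range_succ']
  cases b <;> simp [zeros, Tm.symbol]

theorem entry_cons_true (x : List Bool) (k : ℕ) :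
    entry (true :: x) k = entry x k + if k = 0 then 1 else 0 := by
  rw [entry, List.length_cons, Finset.sum_range_succ']
  simp only [List.getElem?_cons_succ, zeros_cons, Bool.true_eq_false, if_false, add_zero]
  have h0 : zeros (true :: x) 0 = 0 := rfl
  rw [h0]
  simp [entry, Tm.symbol, eq_comm (a := 0)]

theorem entry_cons_false_zero (x : List Bool) : entry (false :: x) 0 = 0 := by
  rw [entry, List.length_cons, Finset.sum_range_succ']
  simp [zeros_cons, Tm.symbol]

theorem entry_cons_false_succ (x : List Bool) (k : ℕ) :
    entry (false :: x) (k + 1) = entry x k := by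
  rw [entry, List.length_cons, Finset.sum_range_succ']
  simp only [List.getElem?_cons_succ, zeros_cons, if_true, Nat.add_right_cancel_iff]
  simp [entry, Tm.symbol]

theorem entry_unary (L : List ℕ) (k : ℕ) : entry (unary L) k = L.getD k 0 := by
  have h : ∀ (n : ℕ) (x : List Bool) (k : ℕ), entry (List.replicate n true ++ false :: x) k =
      if k = 0 then n else entry x (k - 1) := by
    intro n x k
    induction n with
    | zero => cases k <;> simp [entry_cons_false_zero, entry_cons_false_succ]
    | succ n ih =>
      rw [List.replicate_succ, List.cons_append, entry_cons_true, ih]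
      split_ifs <;> rfl
  induction L generalizing k with
  | nil => simp [unary, entry]
  | cons n L ih =>
    have e : unary (n :: L) = List.replicate n true ++ false :: unary L := by simp [unary]
    rw [e, h]
    cases k with
    | zero => simp
    | succ k => simp [ih]

theorem zeros_unary (L : List ℕ) : zeros (unary L) (unary L).length = L.length := by
  have h : ∀ (n : ℕ) (x : List Bool),
      zeros (List.replicate n true ++ false :: x) (List.replicate n true ++ false :: x).length =
      zeros x x.length + 1 := by
    intro n x
    induction n with
    | zero => simp [zeros_cons]
    | succ n ih =>
      rw [List.replicate_succ, List.cons_append, List.length_cons, zeros_cons, ih]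
      simp
  induction L with
  | nil => simp [unary, zeros]
  | cons n L ih =>
    have e : unary (n :: L) = List.replicate n true ++ false :: unary L := by simp [unary]
    rw [e, h, ih, List.length_cons]

theorem exists_unary_iff (x : List Bool) :
    (∃ L, unary L = x) ↔ x.length = 0 ∨ Tm.symbol x[x.length - 1]? = 1 := by
  constructor
  · rintro ⟨L, rfl⟩
    rcases List.eq_nil_or_concat L with rfl | ⟨L, n, rfl⟩
    · exact Or.inl rfl
    · refine Or.inr ?_
      have e : unary (L ++ [n]) = (unary L ++ List.replicate n true) ++ [false] := by
        simp [unary]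
      rw [List.concat_eq_append, e, List.length_append, List.length_singleton,
        Nat.add_sub_cancel, List.getElem?_concat_length]
      rfl
  · induction x with
    | nil => exact fun _ => ⟨[], rfl⟩
    | cons b x ih =>
      intro h
      have h : Tm.symbol (b :: x)[x.length]? = 1 := by simpa using h
      cases b with
      | false =>
        obtain ⟨L, rfl⟩ := ih <| by
          cases x with
          | nil => exact Or.inl rfl
          | cons c x => exact Or.inr (by simpa using h)
        exact ⟨0 :: L, by simp [unary]⟩
      | true =>
        cases x with
        | nil => simp [Tm.symbol] at h
        | cons c x =>
          obtain ⟨L, hL⟩ := ih (Or.inr (by simpa using h))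
          cases L with
          | nil => simp [unary] at hL
          | cons n L => exact ⟨(n + 1) :: L, by rw [← hL]; simp [unary, List.replicate_succ]⟩

/-! In the following definitions, `u` is the sequence of numbers in a description: the five sizes
are `u 0, …, u 4`. -/

/-- The target of a call transition. -/
def callTarget (u : ℕ → ℕ) (s a : ℕ) : ℕ := u (5 + 2 * (s * u 1 + a))

/-- The symbol that is pushed by a call transition. -/
def callSymbol (u : ℕ → ℕ) (s a : ℕ) : ℕ := u (5 + 2 * (s * u 1 + a) + 1)

/-- The target of an internal transition. -/
def intTarget (u : ℕ → ℕ) (s a : ℕ) : ℕ := u (5 + 2 * (u 0 * u 1) + (s * u 2 + a))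

/-- The target of a return transition; the number `h` of the stack symbol is `0` for `⊥` and `g + 1`
for the symbol `g`. -/
def retTarget (u : ℕ → ℕ) (s a h : ℕ) : ℕ :=
  u (5 + 2 * (u 0 * u 1) + u 0 * u 2 + ((s * u 3 + a) * (1 + u 4) + h))

/-- A description with `l` numbers describes an automaton. -/
def IsDescription (u : ℕ → ℕ) (l : ℕ) : Prop :=
  l = 5 + 2 * (u 0 * u 1) + u 0 * u 2 + u 0 * u 3 * (1 + u 4) ∧ 0 < u 0 ∧
  (∀ s < u 0, ∀ a < u 1, callTarget u s a < u 0 ∧ callSymbol u s a < u 4) ∧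
  (∀ s < u 0, ∀ a < u 2, intTarget u s a < u 0) ∧
  ∀ s < u 0, ∀ a < u 3, ∀ h < 1 + u 4, retTarget u s a h < u 0

theorem length_flatMap_finRange {n m : ℕ} (f : Fin n → List ℕ) (hf : ∀ s, (f s).length = m) :
    ((List.finRange n).flatMap f).length = n * m := by
  simp [List.length_flatMap, hf]

theorem getD_flatMap_finRange {n m : ℕ} (f : Fin n → List ℕ) (hf : ∀ s, (f s).length = m)
    (s : Fin n) (j : ℕ) (hj : j < m) :
    ((List.finRange n).flatMap f).getD (s * m + j) 0 = (f s).getD j 0 := by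
  induction n with
  | zero => exact s.elim0
  | succ n ih =>
    rw [List.finRange_succ, List.flatMap_cons, List.flatMap_map]
    refine Fin.cases ?_ (fun s => ?_) s
    · rw [List.getD_append _ _ _ _ (by rw [hf]; simpa using hj)]
      simp
    · rw [List.getD_append_right _ _ _ _ (by rw [hf, Fin.val_succ, add_mul]; omega), hf,
        Fin.val_succ, show (s.val + 1) * m + j - m = s * m + j by rw [add_mul]; omega]
      exact ih (fun s => f s.succ) (fun s => hf _) s

namespace DVPDAInput

variable (A : DVPDAInput)

/-- The sequence of numbers in the description of an automaton. -/
def seq (k : ℕ) : ℕ := A.toNats.getD k 0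

theorem length_callTable : A.callTable.length = 2 * (A.numStates * A.numCalls) := by
  rw [callTable, length_flatMap_finRange (m := A.numCalls * 2)]
  · ring
  · exact fun s => length_flatMap_finRange _ fun _ => rfl

theorem length_intTable : A.intTable.length = A.numStates * A.numInts := by
  rw [intTable, length_flatMap_finRange (m := A.numInts * 1)]
  · ring
  · exact fun s => length_flatMap_finRange _ fun _ => rfl

theorem length_retTable : A.retTable.length = A.numStates * A.numRets * (1 + A.numSymbols) := by
  rw [retTable, length_flatMap_finRange (m := A.numRets * (1 + A.numSymbols))]
  · ring
  · intro s
    refine length_flatMap_finRange _ fun a => ?_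
    rw [List.length_cons, length_flatMap_finRange (m := 1) _ fun _ => rfl]
    ring

theorem length_toNats : A.toNats.length = 5 + 2 * (A.numStates * A.numCalls) +
    A.numStates * A.numInts + A.numStates * A.numRets * (1 + A.numSymbols) := by
  simp only [toNats, List.length_append, length_callTable, length_intTable, length_retTable,
    List.length_cons, List.length_nil]
  ring

theorem seq_call (k : ℕ) (hk : k < 2 * (A.numStates * A.numCalls)) :
    A.seq (5 + k) = A.callTable.getD k 0 := by
  rw [seq, toNats, List.getD_append_right _ _ _ _ (by simp), List.getD_append _ _ _ _
    (by rw [length_callTable]; simpa using hk)]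
  simp

theorem seq_int (k : ℕ) (hk : k < A.numStates * A.numInts) :
    A.seq (5 + 2 * (A.numStates * A.numCalls) + k) = A.intTable.getD k 0 := by
  rw [seq, toNats, List.getD_append_right _ _ _ _ (by simp; omega),
    List.getD_append_right _ _ _ _ (by rw [length_callTable]; simp; omega), List.getD_append _ _ _ _
    (by rw [length_callTable, length_intTable]; simp; omega), length_callTable]
  congr 1
  simp
  omega

theorem seq_ret (k : ℕ) :
    A.seq (5 + 2 * (A.numStates * A.numCalls) + A.numStates * A.numInts + k) =
      A.retTable.getD k 0 := by
  rw [seq, toNats, List.getD_append_right _ _ _ _ (by simp; omega),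
    List.getD_append_right _ _ _ _ (by rw [length_callTable]; simp; omega),
    List.getD_append_right _ _ _ _ (by rw [length_callTable, length_intTable]; simp; omega),
    length_callTable, length_intTable]
  congr 1
  simp
  omega

theorem seq_zero : A.seq 0 = A.numStates := rfl
theorem seq_one : A.seq 1 = A.numCalls := rfl
theorem seq_two : A.seq 2 = A.numInts := rfl
theorem seq_three : A.seq 3 = A.numRets := rfl
theorem seq_four : A.seq 4 = A.numSymbols := rfl

theorem mul_add_lt {n m s j : ℕ} (hs : s < n) (hj : j < m) : s * m + j < n * m := by
  calc s * m + j < (s + 1) * m := by rw [add_mul]; omega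
    _ ≤ n * m := Nat.mul_le_mul_right m hs

theorem exists_mul_add {n m k : ℕ} (hk : k < n * m) : ∃ s < n, ∃ j < m, k = s * m + j := by
  have hm : 0 < m := Nat.pos_of_ne_zero fun h => by simp [h] at hk
  exact ⟨k / m, Nat.div_lt_of_lt_mul (by rwa [mul_comm]), k % m, Nat.mod_lt _ hm,
    by rw [mul_comm]; exact (Nat.div_add_mod k m).symm⟩

theorem callTable_getD (s : Fin A.numStates) (a : Fin A.numCalls) (j : ℕ) (hj : j < 2) :
    A.seq (5 + 2 * (s * A.numCalls + a) + j) =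
      [((A.aut.callTrans s a).1 : ℕ), ((A.aut.callTrans s a).2 : ℕ)].getD j 0 := by
  have h1 := mul_add_lt s.2 a.2
  rw [show 5 + 2 * (s * A.numCalls + a) + j = 5 + (s * (A.numCalls * 2) + (a * 2 + j)) by ring,
    seq_call _ _ (by nlinarith), callTable,
    getD_flatMap_finRange _ (fun s => length_flatMap_finRange (m := 2) _ fun _ => rfl) s _
      (mul_add_lt a.2 hj), getD_flatMap_finRange (m := 2) _ (fun _ => rfl) a j hj]

theorem callTarget_seq (s : Fin A.numStates) (a : Fin A.numCalls) :
    callTarget A.seq s a = (A.aut.callTrans s a).1 := by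
  rw [callTarget, seq_one]
  exact A.callTable_getD s a 0 (by omega)

theorem callSymbol_seq (s : Fin A.numStates) (a : Fin A.numCalls) :
    callSymbol A.seq s a = (A.aut.callTrans s a).2 := by
  rw [callSymbol, seq_one]
  exact A.callTable_getD s a 1 (by omega)

theorem intTarget_seq (s : Fin A.numStates) (a : Fin A.numInts) :
    intTarget A.seq s a = A.aut.intTrans s a := by
  have h1 := mul_add_lt s.2 a.2
  rw [intTarget, seq_two, seq_one, seq_zero, seq_int _ _ h1, intTable]
  have := getD_flatMap_finRange (m := A.numInts * 1)
    (fun s => (List.finRange A.numInts).flatMap fun a => [(A.aut.intTrans s a : ℕ)])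
    (fun s => length_flatMap_finRange _ fun _ => rfl) s (a * 1 + 0) (mul_add_lt a.2 (by omega))
  rw [getD_flatMap_finRange (m := 1) _ (fun _ => rfl) a 0 (by omega)] at this
  simpa using this

/-- The number of a stack symbol in a description. -/
def symbolCode {n : ℕ} : Option (Fin n) → ℕ
  | none => 0
  | some g => g + 1

theorem retTarget_seq (s : Fin A.numStates) (a : Fin A.numRets) (h : Option (Fin A.numSymbols)) :
    retTarget A.seq s a (symbolCode h) = A.aut.retTrans s a h := by
  have hc : symbolCode h < 1 + A.numSymbols := by
    cases h with
    | none => simp [symbolCode]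
    | some g => simp only [symbolCode]; omega
  have hl : ∀ (s : Fin A.numStates) (a : Fin A.numRets), ((A.aut.retTrans s a none : ℕ) ::
      (List.finRange A.numSymbols).flatMap fun g => [(A.aut.retTrans s a (some g) : ℕ)]).length =
      1 + A.numSymbols := by
    intro s a
    rw [List.length_cons, length_flatMap_finRange (m := 1) _ fun _ => rfl]
    ring
  rw [retTarget, seq_four, seq_three, seq_two, seq_one, seq_zero, seq_ret, retTable,
    show (s * A.numRets + a) * (1 + A.numSymbols) + symbolCode h =
      s * (A.numRets * (1 + A.numSymbols)) + (a * (1 + A.numSymbols) + symbolCode h) by ring,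
    getD_flatMap_finRange _ (fun s => length_flatMap_finRange _ (hl s)) s _ (mul_add_lt a.2 hc),
    getD_flatMap_finRange _ (hl s) a _ hc]
  cases h with
  | none => rfl
  | some g =>
    rw [symbolCode, List.getD_cons_succ]
    have := getD_flatMap_finRange (m := 1)
      (fun g => [(A.aut.retTrans s a (some g) : ℕ)]) (fun _ => rfl) g 0 (by omega)
    simpa using this

theorem exists_symbolCode {n h : ℕ} (hh : h < 1 + n) : ∃ o : Option (Fin n), symbolCode o = h := by
  cases h with
  | zero => exact ⟨none, rfl⟩
  | succ h => exact ⟨some ⟨h, by omega⟩, rfl⟩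

theorem isDescription_seq : IsDescription A.seq A.toNats.length := by
  refine ⟨A.length_toNats, A.states_pos, fun s hs a ha => ?_, fun s hs a ha => ?_,
    fun s hs a ha h hh => ?_⟩
  · have h1 := A.callTarget_seq ⟨s, hs⟩ ⟨a, ha⟩
    have h2 := A.callSymbol_seq ⟨s, hs⟩ ⟨a, ha⟩
    simp only at h1 h2
    rw [h1, h2]
    exact ⟨Fin.is_lt _, Fin.is_lt _⟩
  · have h1 := A.intTarget_seq ⟨s, hs⟩ ⟨a, ha⟩
    simp only at h1
    rw [h1]
    exact Fin.is_lt _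
  · obtain ⟨o, rfl⟩ := exists_symbolCode hh
    have h1 := A.retTarget_seq ⟨s, hs⟩ ⟨a, ha⟩ o
    exact h1.trans_lt (Fin.is_lt _)

theorem exists_toNats {L : List ℕ} (h : IsDescription (fun k => L.getD k 0) L.length) :
    ∃ A : DVPDAInput, A.toNats = L := by
  set u : ℕ → ℕ := fun k => L.getD k 0 with hu
  obtain ⟨hl, hq, hc, hi, hr⟩ := h
  have hr' : ∀ s < u 0, ∀ a < u 3, ∀ o : Option (Fin (u 4)),
      retTarget u s a (symbolCode o) < u 0 := fun s hs a ha o => hr s hs a ha _ <| by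
    cases o with
    | none => simp [symbolCode]
    | some g => simp only [symbolCode]; omega
  let A : DVPDAInput :=
    { numStates := u 0
      numCalls := u 1
      numInts := u 2
      numRets := u 3
      numSymbols := u 4
      states_pos := hq
      aut :=
        { callTrans := fun s a =>
            (⟨callTarget u s a, (hc s s.2 a a.2).1⟩, ⟨callSymbol u s a, (hc s s.2 a a.2).2⟩)
          intTrans := fun s a => ⟨intTarget u s a, hi s s.2 a a.2⟩
          retTrans := fun s a o => ⟨retTarget u s a (symbolCode o), hr' s s.2 a a.2 o⟩ } }
  refine ⟨A, ?_⟩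
  have hlen : A.toNats.length = L.length := by rw [length_toNats, hl]
  have hseq : ∀ k < L.length, A.seq k = u k := by
    intro k hk
    by_cases h5 : k < 5
    · interval_cases k <;> rfl
    obtain ⟨k, rfl⟩ := Nat.exists_eq_add_of_le (Nat.le_of_not_lt h5)
    by_cases h1 : k < 2 * (u 0 * u 1)
    · obtain ⟨p, hp, j, hj, rfl⟩ := exists_mul_add (m := 2) (by rwa [mul_comm] at h1)
      obtain ⟨s, hs, a, ha, rfl⟩ := exists_mul_add hp
      have e1 := A.callTarget_seq ⟨s, hs⟩ ⟨a, ha⟩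
      have e2 := A.callSymbol_seq ⟨s, hs⟩ ⟨a, ha⟩
      have : j = 0 ∨ j = 1 := by omega
      rw [mul_comm _ 2, ← add_assoc]
      rcases this with rfl | rfl
      · exact e1
      · exact e2
    obtain ⟨k, rfl⟩ := Nat.exists_eq_add_of_le (Nat.le_of_not_lt h1)
    rw [← add_assoc] at hk ⊢
    by_cases h2 : k < u 0 * u 2
    · obtain ⟨s, hs, a, ha, rfl⟩ := exists_mul_add h2
      exact A.intTarget_seq ⟨s, hs⟩ ⟨a, ha⟩
    obtain ⟨k, rfl⟩ := Nat.exists_eq_add_of_le (Nat.le_of_not_lt h2)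
    rw [← add_assoc] at hk ⊢
    have h3 : k < u 0 * u 3 * (1 + u 4) := by omega
    obtain ⟨p, hp, h, hh, rfl⟩ := exists_mul_add h3
    obtain ⟨s, hs, a, ha, rfl⟩ := exists_mul_add hp
    obtain ⟨o, rfl⟩ := exists_symbolCode hh
    exact A.retTarget_seq ⟨s, hs⟩ ⟨a, ha⟩ o
  refine List.ext_getElem hlen fun k h1 h2 => ?_
  have := hseq k h2
  rw [seq, List.getD_eq_getElem _ _ h1] at this
  exact this.trans (List.getD_eq_getElem _ _ h2)

theorem entry_encode : entry A.encode = A.seq :=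
  funext fun k => entry_unary A.toNats k

/-- The descriptions of automata. -/
theorem exists_encode_iff (x : List Bool) : (∃ A : DVPDAInput, A.encode = x) ↔
    (x.length = 0 ∨ Tm.symbol x[x.length - 1]? = 1) ∧
      IsDescription (entry x) (zeros x x.length) := by
  rw [← exists_unary_iff]
  constructor
  · rintro ⟨A, rfl⟩
    refine ⟨⟨_, rfl⟩, ?_⟩
    have : zeros A.encode A.encode.length = A.toNats.length := zeros_unary A.toNats
    rw [entry_encode, this]
    exact A.isDescription_seq
  · rintro ⟨⟨L, rfl⟩, h⟩
    rw [zeros_unary, funext (entry_unary L)] at h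
    obtain ⟨A, rfl⟩ := exists_toNats h
    exact ⟨A, rfl⟩

end DVPDAInput

/-! ### The induced transformations as a fixed point -/

/-- The rules for `DVPDA.Der` in terms of numbers: the automaton is given by the sequence `u` of the
numbers in its description, and a transformation of its states by a number below `P` whose digits in
base `u 0` are the images of the states. The relation `Y` holds what is derived already; all
components of its elements are bounded. -/
def Rule (u : ℕ → ℕ) (κ : ℕ) (S : StackModel) (J P : ℕ) (Y : ℕ → ℕ → ℕ → ℕ → Prop)
    (d m m' τ : ℕ) : Prop :=
  (m = m' ∧ ∀ s < u 0, digit (u 0) P τ s = s) ∨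
  (∃ τ' < P, Y d m m' τ' ∧ ∃ a < u 2, ∀ s < u 0,
    digit (u 0) P τ s = intTarget u (digit (u 0) P τ' s) a) ∨
  (∃ τ' < P, ∃ m₁ < J, Y d m m₁ τ' ∧ ∃ σ < P, ∃ m₂ < J, Y 0 (DVPDA.turnUp κ m₁) m₂ σ ∧
    m' = DVPDA.turnDown κ m₂ ∧ ∃ a < u 1, ∃ b < u 3, ∀ s < u 0, digit (u 0) P τ s =
      retTarget u (digit (u 0) P σ (callTarget u (digit (u 0) P τ' s) a)) b
        (callSymbol u (digit (u 0) P τ' s) a + 1)) ∨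
  (d = 1 ∧ ∃ τ' < P, Y 1 m m' τ' ∧ ∃ b < u 3, ∀ s < u 0,
    digit (u 0) P τ s = retTarget u (digit (u 0) P τ' s) b 0) ∨
  (d = 2 ∧ Y 1 m m' τ) ∨
  (d = 2 ∧ S ≠ .empty ∧ ∃ τ' < P, ∃ m₁ < J, Y 2 m m₁ τ' ∧ m' = DVPDA.turnUp κ m₁ ∧ ∃ a < u 1,
    (∀ s < u 0, digit (u 0) P τ s = callTarget u (digit (u 0) P τ' s) a) ∧
    (S = .same → ∀ s < u 0, ∀ s' < u 0,
      callSymbol u (digit (u 0) P τ' s) a = callSymbol u (digit (u 0) P τ' s') a))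

theorem Rule.mono {u : ℕ → ℕ} {κ : ℕ} {S : StackModel} {J P : ℕ}
    {Y Y' : ℕ → ℕ → ℕ → ℕ → Prop} (hY : ∀ d m m' τ, Y d m m' τ → Y' d m m' τ) {d m m' τ : ℕ}
    (h : Rule u κ S J P Y d m m' τ) : Rule u κ S J P Y' d m m' τ := by
  rcases h with h | ⟨τ', h1, h2, h3⟩ | ⟨τ', h1, m₁, h2, h3, σ, h4, m₂, h5, h6, h7⟩ |
    ⟨h1, τ', h2, h3, h4⟩ | ⟨h1, h2⟩ | ⟨h1, h2, τ', h3, m₁, h4, h5, h6⟩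
  · exact Or.inl h
  · exact Or.inr (Or.inl ⟨τ', h1, hY _ _ _ _ h2, h3⟩)
  · exact Or.inr (Or.inr (Or.inl
      ⟨τ', h1, m₁, h2, hY _ _ _ _ h3, σ, h4, m₂, h5, hY _ _ _ _ h6, h7⟩))
  · exact Or.inr (Or.inr (Or.inr (Or.inl ⟨h1, τ', h2, hY _ _ _ _ h3, h4⟩)))
  · exact Or.inr (Or.inr (Or.inr (Or.inr (Or.inl ⟨h1, hY _ _ _ _ h2⟩))))
  · exact Or.inr (Or.inr (Or.inr (Or.inr (Or.inr
      ⟨h1, h2, τ', h3, m₁, h4, hY _ _ _ _ h5, h6⟩))))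

/-- The bounds for the components of the derived elements. -/
def InBox (J P d m m' τ : ℕ) : Prop := d < 3 ∧ m < J ∧ m' < J ∧ τ < P

/-- What can be derived in `t` rounds. -/
def level (u : ℕ → ℕ) (κ : ℕ) (S : StackModel) (J P : ℕ) : ℕ → ℕ → ℕ → ℕ → ℕ → Prop
  | 0, _, _, _, _ => False
  | t + 1, d, m, m', τ => InBox J P d m m' τ ∧ Rule u κ S J P (level u κ S J P t) d m m' τ

section level

variable {u : ℕ → ℕ} {κ : ℕ} {S : StackModel} {J P : ℕ}

theorem level_succ (t d m m' τ : ℕ) (h : level u κ S J P t d m m' τ) :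
    level u κ S J P (t + 1) d m m' τ := by
  induction t generalizing d m m' τ with
  | zero => exact h.elim
  | succ t ih => exact ⟨h.1, h.2.mono ih⟩

theorem level_mono {t t' : ℕ} (h : t ≤ t') (d m m' τ : ℕ) (hl : level u κ S J P t d m m' τ) :
    level u κ S J P t' d m m' τ := by
  induction t', h using Nat.le_induction with
  | base => exact hl
  | succ t' _ ih => exact level_succ _ _ _ _ _ ih

/-- The levels are stationary after as many rounds as there are elements. -/
theorem level_stationary (d m m' τ : ℕ)
    (h : level u κ S J P (3 * J * J * P + 1) d m m' τ) :
    level u κ S J P (3 * J * J * P) d m m' τ := by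
  classical
  let F : ℕ → Finset (ℕ × ℕ × ℕ × ℕ) := fun t =>
    (Finset.range 3 ×ˢ Finset.range J ×ˢ Finset.range J ×ˢ Finset.range P).filter
      fun p => level u κ S J P t p.1 p.2.1 p.2.2.1 p.2.2.2
  have hF : ∀ t d m m' τ, (d, m, m', τ) ∈ F t ↔ level u κ S J P t d m m' τ := by
    intro t d m m' τ
    simp only [F, Finset.mem_filter, Finset.mem_product, Finset.mem_range, and_iff_right_iff_imp]
    intro hl
    cases t with
    | zero => exact hl.elim
    | succ t => exact hl.1
  have hmono : Monotone F := fun t t' ht p hp => by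
    obtain ⟨d, m, m', τ⟩ := p
    rw [hF] at hp ⊢
    exact level_mono ht _ _ _ _ hp
  have hcard : ∀ t, (F t).card ≤ 3 * J * J * P := fun t => by
    refine (Finset.card_filter_le _ _).trans (le_of_eq ?_)
    simp [mul_assoc]
  have hstab : ∀ t, (F t).card = (F (t + 1)).card → (F (t + 1)).card = (F (t + 2)).card := by
    intro t ht
    have e1 : F t = F (t + 1) := Finset.eq_of_subset_of_card_le (hmono (Nat.le_succ t)) ht.ge
    have e2 : level u κ S J P t = level u κ S J P (t + 1) := by
      funext d m m' τ
      rw [← hF, e1, hF]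
    congr 1
    ext ⟨d, m, m', τ⟩
    rw [hF, hF]
    change InBox J P d m m' τ ∧ Rule u κ S J P (level u κ S J P t) d m m' τ ↔
      InBox J P d m m' τ ∧ Rule u κ S J P (level u κ S J P (t + 1)) d m m' τ
    rw [← e2]
  have h1 := Nat.stabilises_of_monotone (fun t t' ht => Finset.card_le_card (hmono ht)) hcard
    hstab (Nat.le_succ (3 * J * J * P))
  have h2 := Finset.eq_of_subset_of_card_le (hmono (Nat.le_succ (3 * J * J * P))) h1.le
  rw [← hF, h2, hF]
  exact h

end level

theorem exists_digits {q P : ℕ} (hq : 0 < q) (hP : q ^ q ≤ P) (f : Fin q → Fin q) :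
    ∃ τ < P, ∀ s : Fin q, digit q P τ s = f s := by
  refine ⟨finFunctionFinEquiv f, (Fin.is_lt _).trans_le hP, fun s => ?_⟩
  rw [digit, powCap_eq hq ((Nat.pow_le_pow_right hq s.2.le).trans hP)]
  exact congrArg Fin.val (congrFun (finFunctionFinEquiv.symm_apply_apply f) s)

namespace DVPDAInput

variable (A : DVPDAInput) {κ : ℕ} {S : StackModel} {J P : ℕ}

/-- The transformation of the states given by the digits of a number. -/
def decode (P τ : ℕ) (s : Fin A.numStates) : Fin A.numStates :=
  ⟨digit A.numStates P τ s, Nat.mod_lt _ A.states_pos⟩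

theorem der_of_level {t d m m' τ : ℕ} (h : level A.seq κ S J P t d m m' τ) :
    A.aut.Der κ S d m m' (A.decode P τ) := by
  induction t generalizing d m m' τ with
  | zero => exact h.elim
  | succ t ih =>
    have hD : ∀ (τ : ℕ) (s : Fin A.numStates),
        digit (A.seq 0) P τ s = (A.decode P τ s : ℕ) := fun _ _ => rfl
    rcases h.2 with ⟨rfl, h1⟩ | ⟨τ', -, h2, a, ha, h3⟩ |
      ⟨τ', -, m₁, -, h3, σ, -, m₂, -, h6, rfl, a, ha, b, hb, h7⟩ |
      ⟨rfl, τ', -, h3, b, hb, h4⟩ | ⟨rfl, h2⟩ | ⟨rfl, hS, τ', -, m₁, -, h5, rfl, a, ha, h6, h7⟩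
    · have e : A.decode P τ = fun s => s := funext fun s => Fin.ext (h1 s s.2)
      rw [e]
      exact .id d m
    · have e : A.decode P τ = fun s => A.aut.intTrans (A.decode P τ' s) ⟨a, ha⟩ :=
        funext fun s => Fin.ext <| (h3 s s.2).trans (A.intTarget_seq (A.decode P τ' s) ⟨a, ha⟩)
      rw [e]
      exact (ih h2).int _
    · have e : A.decode P τ = fun s => A.aut.retTrans (A.decode P σ
          (A.aut.callTrans (A.decode P τ' s) ⟨a, ha⟩).1) ⟨b, hb⟩
          (some (A.aut.callTrans (A.decode P τ' s) ⟨a, ha⟩).2) := by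
        refine funext fun s => Fin.ext ((h7 s s.2).trans ?_)
        have e1 := A.callTarget_seq (A.decode P τ' s) ⟨a, ha⟩
        have e2 := A.callSymbol_seq (A.decode P τ' s) ⟨a, ha⟩
        rw [hD τ', e1, e2, hD σ]
        exact A.retTarget_seq _ ⟨b, hb⟩ (some _)
      rw [e]
      exact (ih h3).nest _ _ (ih h6)
    · have e : A.decode P τ = fun s => A.aut.retTrans (A.decode P τ' s) ⟨b, hb⟩ none :=
        funext fun s => Fin.ext <| (h4 s s.2).trans (A.retTarget_seq (A.decode P τ' s) ⟨b, hb⟩ none)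
      rw [e]
      exact (ih h3).ret _
    · exact (ih h2).pending
    · have e : A.decode P τ = fun s => (A.aut.callTrans (A.decode P τ' s) ⟨a, ha⟩).1 :=
        funext fun s => Fin.ext <| (h6 s s.2).trans (A.callTarget_seq (A.decode P τ' s) ⟨a, ha⟩)
      rw [e]
      refine (ih h5).call _ hS fun hs s s' => Fin.ext ?_
      rw [← A.callSymbol_seq, ← A.callSymbol_seq]
      exact h7 hs s s.2 s' s'.2

theorem level_of_der (hP : A.numStates ^ A.numStates ≤ P) {d m m' : ℕ}
    {f : Fin A.numStates → Fin A.numStates} (h : A.aut.Der κ S d m m' f) (hd : d < 3)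
    (hm : m' < J) {τ : ℕ} (hτ : τ < P) (hf : ∀ s : Fin A.numStates, digit A.numStates P τ s = f s) :
    level A.seq κ S J P (3 * J * J * P) d m m' τ := by
  have hnat : ∀ {τ : ℕ} {f : Fin A.numStates → Fin A.numStates},
      (∀ s : Fin A.numStates, digit A.numStates P τ s = f s) → ∀ s (hs : s < A.seq 0),
      digit (A.seq 0) P τ s = f ⟨s, hs⟩ := fun h s hs => h ⟨s, hs⟩
  have hm₀ : m < J := h.le.trans_lt hm
  induction h generalizing τ with
  | id d m =>
    exact level_stationary _ _ _ _ ⟨⟨hd, hm₀, hm, hτ⟩, Or.inl ⟨rfl, fun s hs => hnat hf s hs⟩⟩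
  | @int d m m' f a h ih =>
    obtain ⟨τ', hτ', hf'⟩ := exists_digits A.states_pos hP f
    refine level_stationary _ _ _ _ ⟨⟨hd, hm₀, hm, hτ⟩, Or.inr (Or.inl
      ⟨τ', hτ', ih hd hm hτ' hf' hm₀, a, a.2, fun s hs => ?_⟩)⟩
    rw [hnat hf s hs, hnat hf' s hs, intTarget_seq]
  | @nest d m m₁ m₂ f g a b h₁ h₂ ih₁ ih₂ =>
    have hm₂ : m₂ < J := (DVPDA.le_turnDown κ m₂).trans_lt hm
    have hup : DVPDA.turnUp κ m₁ < J := h₂.le.trans_lt hm₂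
    have hm₁ : m₁ < J := (DVPDA.le_turnUp κ m₁).trans_lt hup
    obtain ⟨τ', hτ', hf'⟩ := exists_digits A.states_pos hP f
    obtain ⟨σ, hσ, hg⟩ := exists_digits A.states_pos hP g
    refine level_stationary _ _ _ _ ⟨⟨hd, hm₀, hm, hτ⟩, Or.inr (Or.inr (Or.inl
      ⟨τ', hτ', m₁, hm₁, ih₁ hd hm₁ hτ' hf' hm₀, σ, hσ, m₂, hm₂,
        ih₂ (by omega) hm₂ hσ hg hup, rfl, a, a.2, b, b.2, fun s hs => ?_⟩))⟩
    rw [hnat hf s hs, hnat hf' s hs, callTarget_seq, callSymbol_seq]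
    change _ = retTarget A.seq (digit A.numStates P σ (A.aut.callTrans (f ⟨s, hs⟩) a).1) _ _
    rw [hg]
    exact (A.retTarget_seq _ b (some _)).symm
  | @ret m m' f b h ih =>
    obtain ⟨τ', hτ', hf'⟩ := exists_digits A.states_pos hP f
    refine level_stationary _ _ _ _ ⟨⟨hd, hm₀, hm, hτ⟩, Or.inr (Or.inr (Or.inr (Or.inl
      ⟨rfl, τ', hτ', ih hd hm hτ' hf' hm₀, b, b.2, fun s hs => ?_⟩)))⟩
    rw [hnat hf s hs, hnat hf' s hs]
    exact (A.retTarget_seq _ b none).symm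
  | pending h ih =>
    exact level_stationary _ _ _ _ ⟨⟨hd, hm₀, hm, hτ⟩, Or.inr (Or.inr (Or.inr (Or.inr (Or.inl
      ⟨rfl, ih (by omega) hm hτ hf hm₀⟩))))⟩
  | @call m m' f a hS hs h ih =>
    have hm' : m' < J := (DVPDA.le_turnUp κ m').trans_lt hm
    obtain ⟨τ', hτ', hf'⟩ := exists_digits A.states_pos hP f
    refine level_stationary _ _ _ _ ⟨⟨hd, hm₀, hm, hτ⟩, Or.inr (Or.inr (Or.inr (Or.inr (Or.inr
      ⟨rfl, hS, τ', hτ', m', hm', ih hd hm' hτ' hf' hm₀, rfl, a, a.2, fun s hs => ?_,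
        fun hS' s hq s' hq' => ?_⟩))))⟩
    · rw [hnat hf s hs, hnat hf' s hs, callTarget_seq]
    · rw [hnat hf' s hq, hnat hf' s' hq', callSymbol_seq, callSymbol_seq]
      exact congrArg Fin.val (hs hS' _ _)

/-- Constant transformations with at most `n` turns, in terms of the levels. -/
theorem exists_der_iff (n : ℕ) (hP : A.numStates ^ A.numStates ≤ P) :
    (∃ m ≤ n, ∃ f, A.aut.Der κ S 2 0 m f ∧ ∃ s, ∀ q, f q = s) ↔
      ∃ m < n + 1, ∃ τ < P, level A.seq κ S (n + 1) P (3 * (n + 1) * (n + 1) * P) 2 0 m τ ∧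
        ∃ s < A.seq 0, ∀ q < A.seq 0, digit (A.seq 0) P τ q = s := by
  constructor
  · rintro ⟨m, hm, f, hf, s, hs⟩
    obtain ⟨τ, hτ, hfτ⟩ := exists_digits A.states_pos hP f
    exact ⟨m, by omega, τ, hτ, A.level_of_der hP hf (by omega) (by omega) hτ hfτ, s, s.2,
      fun q hq => (hfτ ⟨q, hq⟩).trans (congrArg Fin.val (hs _))⟩
  · rintro ⟨m, hm, τ, -, h, s, hs, hq⟩
    exact ⟨m, by omega, _, A.der_of_level h, ⟨s, hs⟩, fun q => Fin.ext (hq q q.2)⟩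

end DVPDAInput

/-! ### The levels in the table -/

/-- Position of an element within its level. -/
def boxCode (J P d m m' τ : ℕ) : ℕ := ((d * J + m) * J + m') * P + τ

/-- What the table holds about the last complete round. The newest bit is the first one; so the bit
of an element is preceded by those of the later elements of its round and by the bits of the round
in progress, of which there are `tab.length % (3 * J * J * P)`. -/
def tableRel (J P : ℕ) (tab : List Bool) (d m m' τ : ℕ) : Prop :=
  InBox J P d m m' τ ∧ Tm.symbol tab[3 * J * J * P + tab.length % (3 * J * J * P) - 1 -
    boxCode J P d m m' τ]? = 2

/-- The next bit of the table. -/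
def tableRule (u : ℕ → ℕ) (κ : ℕ) (S : StackModel) (J P : ℕ) (tab : List Bool) : Prop :=
  let y := tab.length % (3 * J * J * P)
  Rule u κ S J P (tableRel J P tab) (y / P / J / J) (y / P / J % J) (y / P % J) (y % P)

theorem boxCode_lt {J P d m m' τ : ℕ} (h : InBox J P d m m' τ) :
    boxCode J P d m m' τ < 3 * J * J * P :=
  DVPDAInput.mul_add_lt (DVPDAInput.mul_add_lt (DVPDAInput.mul_add_lt h.1 h.2.1) h.2.2.1) h.2.2.2

theorem boxCode_div_mod {J P d m m' τ : ℕ} (h : InBox J P d m m' τ) :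
    boxCode J P d m m' τ / P / J / J = d ∧ boxCode J P d m m' τ / P / J % J = m ∧
      boxCode J P d m m' τ / P % J = m' ∧ boxCode J P d m m' τ % P = τ := by
  obtain ⟨-, h1, h2, h3⟩ := h
  have key : ∀ {a b c : ℕ}, b < c → (a * c + b) / c = a ∧ (a * c + b) % c = b := by
    intro a b c hb
    rw [mul_comm, Nat.mul_add_mod, Nat.mod_eq_of_lt hb, Nat.mul_add_div (by omega),
      Nat.div_eq_of_lt hb]
    exact ⟨rfl, rfl⟩
  unfold boxCode
  rw [(key h3).1, (key h3).2, (key h2).1, (key h2).2, (key h1).1, (key h1).2]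
  exact ⟨rfl, rfl, rfl, rfl⟩

open Classical in
theorem getElem?_table (φ : Ctx → Prop) (x : List Bool) (P a j : ℕ) (hj : j < a) :
    (table φ x P a)[j]? = some (decide (φ (tableCtx x (table φ x P (a - 1 - j)) P))) := by
  induction a generalizing j with
  | zero => omega
  | succ a ih =>
    cases j with
    | zero => rfl
    | succ j =>
      rw [table, List.getElem?_cons_succ, ih j (by omega)]
      congr 5
      omega

theorem symbol_eq_two (o : Option Bool) : Tm.symbol o = 2 ↔ o = some true := by
  rcases o with _ | _ | _ <;> simp [Tm.symbol]

/-- After `t` complete rounds and at any point of the next one, the table holds what can be derived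
in `t` rounds. -/
theorem tableRel_table {u : ℕ → ℕ} {κ : ℕ} {S : StackModel} {J P Q : ℕ} {x : List Bool}
    {φ : Ctx → Prop} (hφ : ∀ tab, φ (tableCtx x tab Q) ↔ tableRule u κ S J P tab) (t y : ℕ)
    (hy : y < 3 * J * J * P) :
    tableRel J P (table φ x Q (t * (3 * J * J * P) + y)) = level u κ S J P t := by
  set X := 3 * J * J * P with hX
  induction t generalizing y with
  | zero =>
    funext d m m' τ
    refine propext ⟨fun ⟨h1, h2⟩ => ?_, fun h => h.elim⟩
    have h3 := boxCode_lt h1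
    rw [← hX, length_table, zero_mul, zero_add, Nat.mod_eq_of_lt hy, symbol_eq_two,
      List.getElem?_eq_none (by rw [length_table]; omega)] at h2
    cases h2
  | succ t ih =>
    funext d m m' τ
    refine propext (and_congr_right fun h1 => ?_)
    have h3 := boxCode_lt h1
    rw [← hX] at h3
    have h4 : ((t + 1) * X + y) % X = y := by
      rw [mul_comm, Nat.mul_add_mod, Nat.mod_eq_of_lt hy]
    have h5 : (t * X + boxCode J P d m m' τ) % X = boxCode J P d m m' τ := by
      rw [mul_comm, Nat.mul_add_mod, Nat.mod_eq_of_lt h3]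
    rw [← hX, length_table, h4, symbol_eq_two, getElem?_table _ _ _ _ _ (by rw [add_mul]; omega),
      show (t + 1) * X + y - 1 - (X + y - 1 - boxCode J P d m m' τ) =
        t * X + boxCode J P d m m' τ by rw [add_mul]; omega]
    simp only [Option.some.injEq, decide_eq_true_eq]
    rw [hφ, tableRule, length_table, ← hX, h5, ih _ h3]
    obtain ⟨e1, e2, e3, e4⟩ := boxCode_div_mod h1
    simp only [e1, e2, e3, e4]

/-! ### The table is computable in polynomial time -/

namespace Cmp

variable {f g h k : Ctx → ℕ}

theorem zeros (hk : Cmp k) : Cmp fun e => zeros e.inp (k e) := by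
  classical
  exact sum (F := fun e i => if Tm.symbol e.inp[i]? = 1 then 1 else 0) hk
    (CmpP.eq (readInp (var 0)) (const 1)).cmp

theorem entry (hk : Cmp k) : Cmp fun e => entry e.inp (k e) :=
  sum (F := fun e i => if Tm.symbol e.inp[i]? = 2 ∧ _root_.zeros e.inp i = k e then 1 else 0) lenInp
    ((CmpP.eq (readInp (var 0)) (const 2)).and (.eq (zeros (var 0)) hk.pop)).cmp

/-- The entries with constant indices, which are the sizes of the automaton. -/
theorem size (i : ℕ) : Cmp fun e => _root_.entry e.inp i := (const i).entry

theorem callTarget (hf : Cmp f) (hg : Cmp g) :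
    Cmp fun e => callTarget (_root_.entry e.inp) (f e) (g e) :=
  ((const 5).add ((const 2).mul ((hf.mul (size 1)).add hg))).entry

theorem callSymbol (hf : Cmp f) (hg : Cmp g) :
    Cmp fun e => callSymbol (_root_.entry e.inp) (f e) (g e) :=
  ((const 5).add ((const 2).mul ((hf.mul (size 1)).add hg))).succ.entry

theorem intTarget (hf : Cmp f) (hg : Cmp g) :
    Cmp fun e => intTarget (_root_.entry e.inp) (f e) (g e) :=
  (((const 5).add ((const 2).mul ((size 0).mul (size 1)))).add ((hf.mul (size 2)).add hg)).entry

theorem retTarget (hf : Cmp f) (hg : Cmp g) (hh : Cmp h) :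
    Cmp fun e => retTarget (_root_.entry e.inp) (f e) (g e) (h e) :=
  ((((const 5).add ((const 2).mul ((size 0).mul (size 1)))).add ((size 0).mul (size 2))).add
    ((((hf.mul (size 3)).add hg).mul ((const 1).add (size 4))).add hh)).entry

theorem turnUp (κ : ℕ) (hf : Cmp f) : Cmp fun e => DVPDA.turnUp κ (f e) :=
  hf.add ((const κ).mul (hf.mod (const 2)))

theorem turnDown (κ : ℕ) (hf : Cmp f) : Cmp fun e => DVPDA.turnDown κ (f e) :=
  hf.add ((const κ).mul (hf.succ.mod (const 2)))

end Cmp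

namespace CmpP

open Cmp

theorem isDescription {l : Ctx → ℕ} (hl : Cmp l) :
    CmpP fun e => IsDescription (entry e.inp) (l e) := by
  refine .and (.eq hl ?_) (.and (.lt zero (size 0)) (.and ?_ (.and ?_ ?_)))
  · exact (((Cmp.const 5).add ((Cmp.const 2).mul ((size 0).mul (size 1)))).add
      ((size 0).mul (size 2))).add
      (((size 0).mul (size 3)).mul ((Cmp.const 1).add (size 4)))
  · exact .all (size 0) <| .all (size 1) <| .and
      (.lt (callTarget (var 1) (var 0)) (size 0)) (.lt (callSymbol (var 1) (var 0)) (size 4))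
  · exact .all (size 0) <| .all (size 2) <| .lt (intTarget (var 1) (var 0)) (size 0)
  · exact .all (size 0) <| .all (size 3) <| .all ((Cmp.const 1).add (size 4)) <|
      .lt (retTarget (var 2) (var 1) (var 0)) (size 0)

variable {P d m m' τ : Ctx → ℕ}

theorem tableRel (J : ℕ) (hP : Cmp P) (hd : Cmp d) (hm : Cmp m) (hm' : Cmp m') (hτ : Cmp τ) :
    CmpP fun e => tableRel J (P e) e.tab (d e) (m e) (m' e) (τ e) := by
  have hX : Cmp fun e => 3 * J * J * P e := (Cmp.const (3 * J * J)).mul hP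
  have hc : Cmp fun e => boxCode J (P e) (d e) (m e) (m' e) (τ e) :=
    (((((hd.mul (.const J)).add hm).mul (.const J)).add hm').mul hP).add hτ
  exact .and (.and (.lt hd (.const 3)) (.and (.lt hm (.const J)) (.and (.lt hm' (.const J))
    (.lt hτ hP)))) (.eq (readTab (((hX.add (lenTab.mod hX)).sub (.const 1)).sub hc)) (.const 2))

theorem rule (κ : ℕ) (S : StackModel) (J : ℕ) (hP : Cmp P) (hd : Cmp d) (hm : Cmp m)
    (hm' : Cmp m') (hτ : Cmp τ) : CmpP fun e =>
      Rule (entry e.inp) κ S J (P e) (_root_.tableRel J (P e) e.tab) (d e) (m e) (m' e) (τ e) := by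
  have dg : ∀ {P x s : Ctx → ℕ}, Cmp P → Cmp x → Cmp s →
      Cmp fun e => digit (entry e.inp 0) (P e) (x e) (s e) :=
    fun h1 h2 h3 => .digit (size 0) h1 h2 h3
  refine .or ?_ (.or ?_ (.or ?_ (.or ?_ (.or ?_ ?_))))
  · exact .and (.eq hm hm') (.all (size 0) (.eq (dg hP.pop hτ.pop (var 0)) (var 0)))
  · exact .ex hP (.and (tableRel J hP.pop hd.pop hm.pop hm'.pop (var 0)) (.ex (size 2)
      (.all (size 0) (.eq (dg hP.pop.pop.pop hτ.pop.pop.pop (var 0))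
        (intTarget (dg hP.pop.pop.pop (var 2) (var 0)) (var 1))))))
  · refine .ex hP (.ex (.const J) (.and
      (tableRel J hP.pop.pop hd.pop.pop hm.pop.pop (var 0) (var 1))
      (.ex hP.pop.pop (.ex (.const J) (.and
        (tableRel J hP.pop.pop.pop.pop .zero (.turnUp κ (var 2)) (var 0) (var 1))
        (.and (.eq hm'.pop.pop.pop.pop (.turnDown κ (var 0))) (.ex (size 1) (.ex (size 3)
          (.all (size 0) (.eq
            (dg hP.pop.pop.pop.pop.pop.pop.pop hτ.pop.pop.pop.pop.pop.pop.pop (var 0)) ?_))))))))))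
    have h : Cmp fun e => digit (entry e.inp 0) (P e.pop.pop.pop.pop.pop.pop.pop) (e.v 6) (e.v 0) :=
      dg hP.pop.pop.pop.pop.pop.pop.pop (var 6) (var 0)
    exact retTarget (dg hP.pop.pop.pop.pop.pop.pop.pop (var 4) (callTarget h (var 2))) (var 1)
      (callSymbol h (var 2)).succ
  · exact .and (.eq hd (.const 1)) (.ex hP (.and
      (tableRel J hP.pop (.const 1) hm.pop hm'.pop (var 0)) (.ex (size 3) (.all (size 0)
        (.eq (dg hP.pop.pop.pop hτ.pop.pop.pop (var 0))
          (retTarget (dg hP.pop.pop.pop (var 2) (var 0)) (var 1) .zero))))))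
  · exact .and (.eq hd (.const 2)) (tableRel J hP (.const 1) hm hm' hτ)
  · refine .and (.eq hd (.const 2)) (.and (.const _) (.ex hP (.ex (.const J) (.and
      (tableRel J hP.pop.pop (.const 2) hm.pop.pop (var 0) (var 1))
      (.and (.eq hm'.pop.pop (.turnUp κ (var 0))) (.ex (size 1) (.and ?_ (.imp (.const _) ?_))))))))
    · exact .all (size 0) (.eq (dg hP.pop.pop.pop.pop hτ.pop.pop.pop.pop (var 0))
        (callTarget (dg hP.pop.pop.pop.pop (var 3) (var 0)) (var 1)))
    · exact .all (size 0) (.all (size 0) (.eq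
        (callSymbol (dg hP.pop.pop.pop.pop.pop (var 4) (var 1)) (var 2))
        (callSymbol (dg hP.pop.pop.pop.pop.pop (var 4) (var 0)) (var 2))))

theorem tableRule (κ : ℕ) (S : StackModel) (J : ℕ) (hP : Cmp P) :
    CmpP fun e => tableRule (entry e.inp) κ S J (P e) e.tab := by
  have hy : Cmp fun e => e.tab.length % (3 * J * J * P e) :=
    lenTab.mod ((Cmp.const (3 * J * J)).mul hP)
  have hJ : Cmp fun _ => J := .const J
  exact rule κ S J hP (((hy.div hP).div hJ).div hJ) (((hy.div hP).div hJ).mod hJ)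
    ((hy.div hP).mod hJ) (hy.mod hP)

end CmpP

/-! ### The decision problems -/

theorem DVPDAInput.numStates_le_length_encode (A : DVPDAInput) : A.numStates ≤ A.encode.length := by
  simp only [encode, toNats, List.cons_append, List.flatMap_cons, List.length_append,
    List.length_replicate]
  omega

/-- It can be decided in exponential time whether a word describes an automaton that lies in a given
class, decidable in polynomial time, and has a derivable constant transformation with at most `n`
turns. -/
theorem inEXP_of_der (κ n : ℕ) (S : StackModel) {F : (ℕ → ℕ) → Prop} {FA : DVPDAInput → Prop}
    (hF : CmpP fun e => F (entry e.inp)) (hFA : ∀ A : DVPDAInput, F A.seq ↔ FA A)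
    {W : DVPDAInput → Prop} (hW : ∀ A : DVPDAInput, W A ↔
      ∃ m ≤ n, ∃ f, A.aut.Der κ S 2 0 m f ∧ ∃ s, ∀ q, f q = s) :
    InEXP {x | ∃ A : DVPDAInput, A.encode = x ∧ FA A ∧ W A} := by
  have hP : Cmp fun e => e.v 0 := .var 0
  have hX : Cmp fun e => 3 * (n + 1) * (n + 1) * e.v 0 :=
    (Cmp.const (3 * (n + 1) * (n + 1))).mul hP
  have hψ : CmpP fun e => ((e.inp.length = 0 ∨ Tm.symbol e.inp[e.inp.length - 1]? = 1) ∧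
      IsDescription (entry e.inp) (zeros e.inp e.inp.length)) ∧ F (entry e.inp) ∧
      ∃ m < n + 1, ∃ τ < e.v 0, tableRel (n + 1) (e.v 0) e.tab 2 0 m τ ∧
        ∃ s < entry e.inp 0, ∀ q < entry e.inp 0, digit (entry e.inp 0) (e.v 0) τ q = s := by
    refine .and (.and (.or (.eq_zero .lenInp) (.eq (.readInp (.sub .lenInp (.const 1))) (.const 1)))
      (.isDescription (.zeros .lenInp))) (.and hF (.ex (.const (n + 1)) (.ex hP.pop (.and
        (.tableRel (n + 1) (.var 2) (.const 2) .zero (.var 1) (.var 0)) (.ex (.size 0) (.all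
          (.size 0) (.eq (.digit (.size 0) (.var 4) (.var 2) (.var 0)) (.var 1))))))))
  -- as many rounds as there are elements, each of which fills one bit per element
  refine inEXP_of_table (hX.mul hX) (.tableRule κ S (n + 1) hP) hψ _ fun x => ?_
  set P := x.length ^ x.length with hPdef
  -- this includes the empty input, for which `P = 0 ^ 0 = 1`
  have hP0 : 0 < P := by
    rcases Nat.eq_zero_or_pos x.length with h | h
    · simp [hPdef, h]
    · exact Nat.pow_pos h
  have hX0 : 0 < 3 * (n + 1) * (n + 1) * P := by positivity
  have key : ∀ A : DVPDAInput, A.encode = x → (W A ↔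
      ∃ m < n + 1, ∃ τ < P, tableRel (n + 1) P (table
        (fun e => tableRule (entry e.inp) κ S (n + 1) (e.v 0) e.tab) x P
        (3 * (n + 1) * (n + 1) * P * (3 * (n + 1) * (n + 1) * P))) 2 0 m τ ∧
        ∃ s < entry x 0, ∀ q < entry x 0, digit (entry x 0) P τ q = s) := by
    rintro A rfl
    have hq : A.numStates ^ A.numStates ≤ P :=
      (Nat.pow_le_pow_left A.numStates_le_length_encode _).trans (Nat.pow_le_pow_right
        (A.states_pos.trans_le A.numStates_le_length_encode) A.numStates_le_length_encode)
    have h := tableRel_table (u := entry A.encode) (κ := κ) (S := S) (J := n + 1) (P := P) (Q := P)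
      (x := A.encode) (φ := fun e => tableRule (entry e.inp) κ S (n + 1) (e.v 0) e.tab)
      (fun _ => Iff.rfl) (3 * (n + 1) * (n + 1) * P) 0 hX0
    rw [add_zero] at h
    rw [h, A.entry_encode, hW, A.exists_der_iff n hq]
  constructor
  · rintro ⟨A, hA, hFA', hWA⟩
    refine ⟨(DVPDAInput.exists_encode_iff x).1 ⟨A, hA⟩, ?_, (key A hA).1 hWA⟩
    have : F A.seq := (hFA A).2 hFA'
    rwa [← A.entry_encode, hA] at this
  · rintro ⟨h1, h2, h3⟩
    obtain ⟨A, hA⟩ := (DVPDAInput.exists_encode_iff x).2 h1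
    refine ⟨A, hA, (hFA A).1 ?_, (key A hA).2 h3⟩
    rw [← A.entry_encode, hA]
    exact h2

theorem inEXP_synchronizes (S : StackModel) {F : (ℕ → ℕ) → Prop} {FA : DVPDAInput → Prop}
    (hF : CmpP fun e => F (entry e.inp)) (hFA : ∀ A : DVPDAInput, F A.seq ↔ FA A) :
    InEXP {x | ∃ A : DVPDAInput, A.encode = x ∧ FA A ∧ ∃ w, A.aut.Synchronizes S w} :=
  inEXP_of_der 0 0 S hF hFA (W := fun A => ∃ w, A.aut.Synchronizes S w) fun A =>
    haveI : Nonempty (Fin A.numStates) := ⟨⟨0, A.states_pos⟩⟩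
    A.aut.exists_synchronizes_iff' S

theorem inEXP_turnSynchronizes (n : ℕ) (S : StackModel) {F : (ℕ → ℕ) → Prop}
    {FA : DVPDAInput → Prop} (hF : CmpP fun e => F (entry e.inp))
    (hFA : ∀ A : DVPDAInput, F A.seq ↔ FA A) :
    InEXP {x | ∃ A : DVPDAInput, A.encode = x ∧ FA A ∧ ∃ w, A.aut.TurnSynchronizes n S w} :=
  inEXP_of_der 1 n S hF hFA (W := fun A => ∃ w, A.aut.TurnSynchronizes n S w) fun A =>
    haveI : Nonempty (Fin A.numStates) := ⟨⟨0, A.states_pos⟩⟩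
    A.aut.exists_turnSynchronizes_iff n S

/-- Membership in a class, in terms of the numbers in the description of an automaton. -/
def AutomatonClass.ContainsSeq : AutomatonClass → (ℕ → ℕ) → Prop
  | .dvpda, _ => True
  | .dvvpda, u => ∀ a < u 1, ∀ p < u 0, ∀ q < u 0, callSymbol u p a = callSymbol u q a
  | .dvca, u => u 4 = 1

theorem AutomatonClass.cmpP_containsSeq (𝒞 : AutomatonClass) :
    CmpP fun e => 𝒞.ContainsSeq (entry e.inp) :=
  match 𝒞 with
  | .dvpda => .const True
  | .dvvpda => .all (.size 1) <| .all (.size 0) <| .all (.size 0) <|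
      .eq (.callSymbol (.var 1) (.var 2)) (.callSymbol (.var 0) (.var 2))
  | .dvca => .eq (.size 4) (.const 1)

theorem AutomatonClass.containsSeq_iff (𝒞 : AutomatonClass) (A : DVPDAInput) :
    𝒞.ContainsSeq A.seq ↔ 𝒞.Contains A := by
  cases 𝒞 with
  | dvpda => exact Iff.rfl
  | dvca => exact Iff.rfl
  | dvvpda =>
    constructor
    · intro h a p q
      have := h a a.2 p p.2 q q.2
      rw [A.callSymbol_seq, A.callSymbol_seq] at this
      exact Fin.ext this
    · intro h a ha p hp q hq
      have e1 := A.callSymbol_seq ⟨p, hp⟩ ⟨a, ha⟩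
      have e2 := A.callSymbol_seq ⟨q, hq⟩ ⟨a, ha⟩
      exact e1.trans ((congrArg Fin.val (h _ _ _)).trans e2.symm)

theorem mainTheorem2 (S : StackModel) :
    (∀ 𝒞 : AutomatonClass,
      InEXP (SyncProblem 𝒞 S) ∧ ∀ n : ℕ, InEXP (TurnSyncProblem n 𝒞 S)) ∧
    InEXP (SyncNoReturnProblem S) ∧ InEXP (SyncReturnProblem S) :=
  ⟨fun 𝒞 => ⟨inEXP_synchronizes S 𝒞.cmpP_containsSeq 𝒞.containsSeq_iff,
    fun n => inEXP_turnSynchronizes n S 𝒞.cmpP_containsSeq 𝒞.containsSeq_iff⟩,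
    inEXP_synchronizes S (F := fun u => u 3 = 0) (.eq_zero (.size 3)) fun _ => Iff.rfl,
    inEXP_synchronizes S (F := fun u => u 3 ≠ 0) (.not (.eq_zero (.size 3))) fun _ => Iff.rfl⟩
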